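/- Let $d\ge 1$, $k\ge 2$ and $M\ge 0$ be integers. Consider a directed graph with two composable edges $(u,v)$, $(v,w)$ and $k-2$ nuisance edges $(q_i,r_i)$, where the $2k-1$ vertices $u,v,w,q_i,r_i$ are pairwise distinct, together with $M$ spurious edges $(a_1,b_1),\dots,(a_M,b_M)$ such that, for each $m$, the vertices $a_m\neq b_m$ are not vertices of the graph. Represent the vertices by independent random vectors (denoted by the same letters), each uniformly distributed on the unit sphere $\mathbb S^{d-1}\subset\mathbb R^d$, and embed the graph as the $d\times d$ matrix \[ G = uv^T + vw^T + \sum_{i=1}^{k-2} q_i r_i^T . \] After edge composition by the matrix square $G^2$, let $T = u^T G^2 w$ be the query score of the composed edge $(u,w)$, let $F_m = a_m^T G^2 b_m$ be the query score of the $m$-th spurious edge, and let $A$ be the event that $T > F_m$ for all $m=1,\dots,M$. Put \[ \sigma^2 = \frac{2k-1}{d^2} + \frac{2k^2-2k}{d^3} . \] Then the following hold. 1. There is a universal constant $C_0>0$ such that, for all $d\ge 1$, $k\ge 2$, $M\ge 0$, \[ P(A) \ \ge\ 1 - M\Bigl(\exp\bigl(-C_0/\sigma^2\bigr) + \exp(-C_0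 d)\Bigr) . \] That is, $P(A)\gtrapprox 1-M\exp(-C_0/\sigma^2)$ up to an error of $\exp(-C_0d)$ per spurious edge. 2. If the number of edges is large, in the sense that $k\ge\kappa d$ for a fixed $\kappa>0$, then no error term is needed: for every $\kappa>0$ there is a constant $C>0$, depending only on $\kappa$, such that for all $d\ge 1$, $k\ge\max(2,\kappa d)$ and $M\ge 0$, \[ P(A)\ \ge\ 1 - M\exp\bigl(-C/\sigma^2\bigr) \qquad\text{and}\qquad P(A)\ \ge\ 1 - M\exp\bigl(-C d^3/k^2\bigr) . \] -/

import Mathlib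

open MeasureTheory ProbabilityTheory

noncomputable section

namespace TensorSpherical

/-- The unit sphere `𝕊^{d-1}` of `ℝ^d`, in which the vertex codes live. -/
abbrev UnitSphere (d : ℕ) : Type := Metric.sphere (0 : EuclideanSpace ℝ (Fin d)) 1

/-- The uniform probability measure on the unit sphere `𝕊^{d-1}`: normalized surface measure. -/
def sphereUniform (d : ℕ) : Measure (UnitSphere d) :=
  ((volume : Measure (EuclideanSpace ℝ (Fin d))).toSphere Set.univ)⁻¹ •
    (volume : Measure (EuclideanSpace ℝ (Fin d))).toSphere

/-- Tensor product binding: the edge from `x` to `y` is embedded as the matrix `x yᵀ`. -/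
def bind {d : ℕ} (x y : UnitSphere d) : Matrix (Fin d) (Fin d) ℝ :=
  Matrix.vecMulVec x.1.ofLp y.1.ofLp

/-- Edge query: the score `xᵀ G y` of the candidate edge `(x, y)`. -/
def edgeQuery {d : ℕ} (G : Matrix (Fin d) (Fin d) ℝ) (x y : UnitSphere d) : ℝ :=
  x.1.ofLp ⬝ᵥ (Matrix.mulVec G y.1.ofLp)

/-- The embedding `u vᵀ + v wᵀ + ∑ i, qᵢ rᵢᵀ` of the graph with edges `(u, v)`, `(v, w)` and
`(qᵢ, rᵢ)`, where the vertex `x` is represented by its code `φ x`. -/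
def graphEmbedding {V : Type*} {d n : ℕ} (φ : V → UnitSphere d) (u v w : V) (q r : Fin n → V) :
    Matrix (Fin d) (Fin d) ℝ :=
  bind (φ u) (φ v) + bind (φ v) (φ w) + ∑ i, bind (φ (q i)) (φ (r i))

/-- The list of all the vertices `u, v, w, qᵢ, rᵢ` of the graph. It is injective exactly when these
vertices are pairwise distinct, and its range is the vertex set of the graph. -/
def graphVertex {V : Type*} {n : ℕ} (u v w : V) (q r : Fin n → V) :
    Fin 3 ⊕ (Fin n ⊕ Fin n) → V :=
  Sum.elim ![u, v, w] (Sum.elim q r)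

/-- The score of the candidate edge `(x, y)` after edge composition, that is, after squaring the
graph embedding. -/
def composedScore {V : Type*} {d n : ℕ} (φ : V → UnitSphere d) (u v w : V) (q r : Fin n → V)
    (x y : V) : ℝ :=
  edgeQuery (graphEmbedding φ u v w q r ^ 2) (φ x) (φ y)

/-- `σ² = (2k - 1) / d² + (2k² - 2k) / d³`. -/
def noiseVar (d k : ℕ) : ℝ :=
  (2 * (k : ℝ) - 1) / (d : ℝ) ^ 2 + (2 * (k : ℝ) ^ 2 - 2 * (k : ℝ)) / (d : ℝ) ^ 3

end TensorSpherical

end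

namespace TensorSpherical

open scoped RealInnerProductSpace Pointwise ENNReal

/-! By a union bound it suffices that one spurious edge wins with probability at most `exp (-c d³ /
(d + k)²)`. Only `σ² ≥ k² / d³` is then needed: for `k ≤ d` the exponent is at least `c d / 4`,
which is the error term, for `k ≥ d` at least `c / (4 σ²)`, and `κ d ≤ k` makes `d + k` comparable
to `k`.

Write `N = ∑ qᵢ rᵢᵀ`. Expanding, `T - 1` is controlled by terms each containing the inner product of
a code with a vector independent of it (`v`, `N w`, `N v`, `N (N w)`); likewise `F = ⟪a, G (G b)⟫`,
where `a` is independent of `G` and `b`. Once `‖N‖ = O(m)` with `m² = 1 + k/d`, these vectors have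
norm `O(m²)`, and the spherical cap bound makes every term small outside probability `exp (-c d /
m⁴)`, where `d / m⁴ = d³ / (d + k)²`.

The norm bound comes from sub-exponential tails of `∑ ⟪qᵢ, z⟫ ⟪rᵢ, x⟫` for fixed `z, x`. An average
over balls replaces the usual net: an operator of large norm has a large bilinear form on a whole
product of small balls, so Fubini costs only a factor `64 ^ d`.

This gives `13 exp (-x)`, which is vacuous for small `x`. A bound `7/8` free of dimension removes
the prefactor: among the eight sign choices for `u`, for all `qᵢ` together and for `a`, at least one
makes the true score win, and the law is invariant under these flips. -/

/-! ### Concentration for the uniform measure on the sphere. -/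

/-- A set whose cone in the unit ball has small volume has small uniform measure. -/
lemma sphereUniform_le {d : ℕ} [NeZero d] {S : Set (UnitSphere d)} (hS : MeasurableSet S)
    {c : ℝ≥0∞}
    (h : (volume : Measure (EuclideanSpace ℝ (Fin d))) (Set.Ioo (0 : ℝ) 1 • (Subtype.val '' S)) ≤
      c * volume (Metric.ball (0 : EuclideanSpace ℝ (Fin d)) 1)) :
    sphereUniform d S ≤ c := by
  have hd : (d : ℝ≥0∞) ≠ 0 := by exact_mod_cast NeZero.ne d
  have hb0 : volume (Metric.ball (0 : EuclideanSpace ℝ (Fin d)) 1) ≠ 0 :=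
    (Metric.measure_ball_pos _ _ one_pos).ne'
  have hbt : volume (Metric.ball (0 : EuclideanSpace ℝ (Fin d)) 1) ≠ ⊤ := measure_ball_lt_top.ne
  rw [sphereUniform, Measure.smul_apply, Measure.toSphere_apply_univ, Measure.toSphere_apply' _ hS,
    smul_eq_mul, finrank_euclideanSpace_fin, mul_comm, ← div_eq_mul_inv]
  refine ENNReal.div_le_of_le_mul ?_
  calc _ ≤ (d : ℝ≥0∞) * (c * volume (Metric.ball (0 : EuclideanSpace ℝ (Fin d)) 1)) := by gcongr
    _ = _ := by ring

instance isProbabilityMeasure_sphereUniform (d : ℕ) [NeZero d] :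
    IsProbabilityMeasure (sphereUniform d) := by
  constructor
  rw [sphereUniform, Measure.smul_apply, smul_eq_mul]
  exact ENNReal.inv_mul_cancel (Measure.measure_univ_ne_zero.2 (Measure.toSphere_ne_zero _))
    (measure_ne_top _ _)

/-- This symmetry gives both the zero mean of linear functionals and the invariance under sign
flips. -/
lemma measurePreserving_neg_sphereUniform (d : ℕ) [NeZero d] :
    MeasurePreserving (fun x : UnitSphere d => -x) (sphereUniform d) (sphereUniform d) := by
  have hm : Measurable (fun x : UnitSphere d => -x) := continuous_neg.measurable
  refine ⟨hm, ?_⟩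
  ext S hS
  rw [Measure.map_apply hm hS, sphereUniform, Measure.smul_apply, Measure.smul_apply,
    Measure.toSphere_apply' _ (hm hS), Measure.toSphere_apply' _ hS]
  congr 2
  have : Set.Ioo (0 : ℝ) 1 • (Subtype.val '' ((fun x : UnitSphere d => -x) ⁻¹' S)) =
      -(Set.Ioo (0 : ℝ) 1 • (Subtype.val '' S)) := by
    rw [← Set.smul_neg]
    congr 1
    ext y
    constructor
    · rintro ⟨x, hx, rfl⟩
      exact ⟨-x, hx, by simp⟩
    · rintro ⟨x, hx, hxy⟩
      exact ⟨-x, by simpa using hx, by simp [hxy]⟩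
  rw [this, Measure.measure_neg]

/-- The spherical cap bound. -/
lemma sphereUniform_cap_le {d : ℕ} [NeZero d] {z : EuclideanSpace ℝ (Fin d)} (hz : ‖z‖ ≤ 1)
    {t : ℝ} (ht : 0 ≤ t) :
    sphereUniform d {x | t ≤ ⟪x.1, z⟫} ≤ ENNReal.ofReal (Real.exp (-(d * t ^ 2 / 4))) := by
  have key : ∀ s : ℝ, 0 ≤ s → s ^ 2 ≤ 1 / 2 →
      sphereUniform d {x | s ≤ ⟪x.1, z⟫} ≤ ENNReal.ofReal (Real.exp (-(d * s ^ 2 / 2))) := by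
    intro s hs hs2
    have hmeas : MeasurableSet {x : UnitSphere d | s ≤ ⟪x.1, z⟫} :=
      (isClosed_le continuous_const (by fun_prop)).measurableSet
    refine sphereUniform_le hmeas ?_
    have hr : 0 ≤ Real.exp (-(s ^ 2 / 2)) := (Real.exp_pos _).le
    -- The cone over the cap lies in a ball of squared radius `1 - s² ≤ exp (-s²)` about `s • z`.
    -- The bound on the squared distance is convex in `r`; the endpoint `r = 0` is where `s² ≤ 1/2`
    -- is needed.
    have hsub : Set.Ioo (0 : ℝ) 1 • (Subtype.val '' {x : UnitSphere d | s ≤ ⟪x.1, z⟫}) ⊆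
        Metric.closedBall (s • z) (Real.exp (-(s ^ 2 / 2))) := by
      rintro _ ⟨r, ⟨hr0, hr1⟩, _, ⟨x, hx, rfl⟩, rfl⟩
      rw [mem_closedBall_iff_norm]
      refine (sq_le_sq₀ (norm_nonneg _) hr).1 ?_
      have hx1 : ‖x.1‖ = 1 := by simp
      have hx' : s ≤ ⟪x.1, z⟫ := hx
      have hz2 : ‖z‖ ^ 2 ≤ 1 := pow_le_one₀ (norm_nonneg _) hz
      have e1 : Real.exp (-(s ^ 2 / 2)) ^ 2 = Real.exp (-s ^ 2) := by
        rw [← Real.exp_nat_mul]; congr 1; push_cast; ring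
      have e2 := Real.add_one_le_exp (-s ^ 2)
      simp only
      rw [e1, norm_sub_sq_real, norm_smul, norm_smul, hx1, real_inner_smul_left,
        real_inner_smul_right, Real.norm_eq_abs, Real.norm_eq_abs, mul_pow, mul_pow, sq_abs, sq_abs]
      have h1 : r * s * s ≤ r * (s * ⟪x.1, z⟫) := by
        rw [mul_assoc]; gcongr
      have h2 : s ^ 2 * ‖z‖ ^ 2 ≤ s ^ 2 := by nlinarith [sq_nonneg s]
      have h3 : r ^ 2 - 2 * (r * s * s) + s ^ 2 ≤ 1 - s ^ 2 := by
        nlinarith [mul_pos hr0 (sub_pos.2 hr1), sub_pos.2 hr1]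
      linarith
    refine (measure_mono hsub).trans ?_
    rw [Measure.addHaar_closedBall _ _ hr, finrank_euclideanSpace_fin, ← Real.exp_nat_mul]
    apply le_of_eq
    congr 3
    ring
  rcases le_total (t ^ 2) (1 / 2) with h | h
  · refine (key t ht h).trans (ENNReal.ofReal_le_ofReal (Real.exp_le_exp.2 ?_))
    have : 0 ≤ d * t ^ 2 := by positivity
    linarith
  -- For `1/2 ≤ t² ≤ 1` the cap at height `√(1/2)` suffices, at the price of 4 instead of 2 in the
  -- exponent.
  · rcases le_or_gt t 1 with h1 | h1
    · have hs : (√(1 / 2)) ^ 2 = 1 / 2 := Real.sq_sqrt (by norm_num)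
      have hst : √(1 / 2) ≤ t := by
        rw [Real.sqrt_le_left ht]; exact h
      refine (measure_mono fun x hx => hst.trans hx).trans
        ((key (√(1 / 2)) (Real.sqrt_nonneg _) hs.le).trans
          (ENNReal.ofReal_le_ofReal (Real.exp_le_exp.2 ?_)))
      rw [hs]
      have : t ^ 2 ≤ 1 := pow_le_one₀ ht h1
      have : d * t ^ 2 ≤ d * 1 := by gcongr
      linarith
    · have : {x : UnitSphere d | t ≤ ⟪x.1, z⟫} = ∅ := by
        ext x
        simp only [Set.mem_ofPred_eq, Set.mem_empty_iff_false, iff_false, not_le]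
        have hx1 : ‖x.1‖ = 1 := by simp
        have := real_inner_le_norm x.1 z
        rw [hx1, one_mul] at this
        linarith
      simp [this]

lemma sphereUniform_abs_inner_ge_le {d : ℕ} [NeZero d] {z : EuclideanSpace ℝ (Fin d)} {L : ℝ}
    (hL : 0 < L) (hz : ‖z‖ ≤ L) {t : ℝ} (ht : 0 ≤ t) :
    sphereUniform d {x | t ≤ |⟪x.1, z⟫|} ≤
      ENNReal.ofReal (2 * Real.exp (-(d * t ^ 2 / (4 * L ^ 2)))) := by
  have h1 : ∀ e : ℝ, |e| = 1 → sphereUniform d {x | t / L ≤ ⟪x.1, (e / L) • z⟫} ≤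
      ENNReal.ofReal (Real.exp (-(d * t ^ 2 / (4 * L ^ 2)))) := by
    intro e he
    have hz' : ‖(e / L) • z‖ ≤ 1 := by
      rw [norm_smul, Real.norm_eq_abs, abs_div, he, abs_of_pos hL, one_div, inv_mul_le_iff₀ hL]
      simpa using hz
    refine (sphereUniform_cap_le hz' (div_nonneg ht hL.le)).trans (le_of_eq ?_)
    congr 3
    field_simp
  have hsub : {x : UnitSphere d | t ≤ |⟪x.1, z⟫|} ⊆
      {x | t / L ≤ ⟪x.1, (1 / L) • z⟫} ∪ {x | t / L ≤ ⟪x.1, ((-1) / L) • z⟫} := by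
    intro x hx
    simp only [Set.mem_ofPred_eq, Set.mem_union, real_inner_smul_right] at hx ⊢
    rcases le_abs.1 hx with h | h
    · left
      rw [div_mul_eq_mul_div, one_mul]; gcongr
    · right
      rw [div_mul_eq_mul_div, neg_one_mul]; gcongr
  refine (measure_mono hsub).trans ((measure_union_le _ _).trans ?_)
  rw [two_mul, ENNReal.ofReal_add (Real.exp_pos _).le (Real.exp_pos _).le]
  exact add_le_add (h1 1 (by simp)) (h1 (-1) (by simp))

lemma integrable_of_continuous {d : ℕ} [NeZero d] {f : UnitSphere d → ℝ} (hf : Continuous f) :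
    Integrable f (sphereUniform d) :=
  hf.integrable_of_hasCompactSupport (HasCompactSupport.of_compactSpace f)

/-- Uniform sub-Gaussianity of the linear functionals on the sphere. -/
lemma integral_exp_sq_inner_le {d : ℕ} [NeZero d] {z : EuclideanSpace ℝ (Fin d)} {L : ℝ}
    (hL : 0 < L) (hz : ‖z‖ ≤ L) :
    ∫ x, Real.exp (d * ⟪x.1, z⟫ ^ 2 / (8 * L ^ 2)) ∂(sphereUniform d) ≤ 3 := by
  have hd : (0 : ℝ) < d := by exact_mod_cast Nat.pos_of_ne_zero (NeZero.ne d)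
  have hc : Continuous fun x : UnitSphere d => Real.exp (d * ⟪x.1, z⟫ ^ 2 / (8 * L ^ 2)) := by
    fun_prop
  rw [(integrable_of_continuous hc).integral_eq_integral_meas_le
    (.of_forall fun x => (Real.exp_pos _).le)]
  -- The constant 8 is twice that of the cap bound, so the tail is `2 τ⁻²`. The layer-cake integral
  -- is then at most `1` over `(0, 1]` plus `2` over `(1, ∞)`.
  have htail : ∀ τ : ℝ, 1 ≤ τ → (sphereUniform d).real
      {x | τ ≤ Real.exp (d * ⟪x.1, z⟫ ^ 2 / (8 * L ^ 2))} ≤ 2 * τ ^ (-2 : ℝ) := by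
    intro τ hτ
    have hτ0 : 0 < τ := by linarith
    have hlog : 0 ≤ Real.log τ := Real.log_nonneg hτ
    have hs : √(8 * L ^ 2 * Real.log τ / d) ^ 2 = 8 * L ^ 2 * Real.log τ / d :=
      Real.sq_sqrt (by positivity)
    have h := sphereUniform_abs_inner_ge_le hL hz (Real.sqrt_nonneg (8 * L ^ 2 * Real.log τ / d))
    rw [hs] at h
    have he : Real.exp (-(d * (8 * L ^ 2 * Real.log τ / d) / (4 * L ^ 2))) = τ ^ (-2 : ℝ) := by
      rw [Real.rpow_def_of_pos hτ0]
      congr 1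
      field_simp
      ring
    rw [he] at h
    refine ENNReal.toReal_le_of_le_ofReal (by positivity) (le_trans (measure_mono ?_) h)
    intro x hx
    simp only [Set.mem_ofPred_eq] at hx ⊢
    rw [← Real.log_le_iff_le_exp hτ0] at hx
    apply Real.sqrt_le_iff.2
    refine ⟨abs_nonneg _, ?_⟩
    rw [sq_abs, div_le_iff₀ hd]
    rw [le_div_iff₀ (by positivity)] at hx
    linarith
  have hint : IntegrableOn (fun τ : ℝ => 2 * τ ^ (-2 : ℝ)) (Set.Ioi 1) :=
    (integrableOn_Ioi_rpow_of_lt (by norm_num) one_pos).const_mul 2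
  have hmeas : AEStronglyMeasurable (fun τ : ℝ => (sphereUniform d).real
      {x | τ ≤ Real.exp (d * ⟪x.1, z⟫ ^ 2 / (8 * L ^ 2))}) := by
    refine (Antitone.measurable fun a b hab => ?_).aestronglyMeasurable
    exact measureReal_mono fun x hx => le_trans hab hx
  have hint1 : IntegrableOn (fun τ : ℝ => (sphereUniform d).real
      {x | τ ≤ Real.exp (d * ⟪x.1, z⟫ ^ 2 / (8 * L ^ 2))}) (Set.Ioi 1) := by
    refine Integrable.mono' hint hmeas.restrict ?_
    filter_upwards [ae_restrict_mem measurableSet_Ioi] with τ hτ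
    rw [Real.norm_of_nonneg measureReal_nonneg]
    exact htail τ (le_of_lt hτ)
  have hint0 : IntegrableOn (fun τ : ℝ => (sphereUniform d).real
      {x | τ ≤ Real.exp (d * ⟪x.1, z⟫ ^ 2 / (8 * L ^ 2))}) (Set.Ioc 0 1) := by
    refine Integrable.mono' (integrableOn_const (C := (1 : ℝ)) (by simp)) hmeas.restrict
      (.of_forall fun τ => ?_)
    rw [Real.norm_of_nonneg measureReal_nonneg]
    exact measureReal_le_one
  rw [← Set.Ioc_union_Ioi_eq_Ioi zero_le_one,
    setIntegral_union Set.Ioc_disjoint_Ioi_same measurableSet_Ioi hint0 hint1]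
  have b0 := setIntegral_mono (g := fun _ => (1 : ℝ)) hint0 (integrableOn_const (by simp))
    (fun τ => measureReal_le_one)
  have b1 := setIntegral_mono_on hint1 hint measurableSet_Ioi (fun τ hτ => htail τ (le_of_lt hτ))
  rw [integral_const_mul, integral_Ioi_rpow_of_lt (by norm_num) one_pos] at b1
  norm_num at b0 b1 ⊢
  linarith

/-! ### Sub-exponential tails of sums of products. -/

lemma exp_le_one_add_add_sq_mul_exp_abs (t : ℝ) :
    Real.exp t ≤ 1 + t + t ^ 2 * Real.exp |t| := by
  have h : ∀ s : ℝ, Real.exp s - 1 ≤ s * Real.exp s := fun s => by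
    have h1 := Real.add_one_le_exp (-s)
    have h2 : Real.exp (-s) * Real.exp s = 1 := by rw [← Real.exp_add]; simp
    nlinarith [Real.exp_pos s]
  have h1 := h t
  rcases le_total 0 t with ht | ht
  · rw [abs_of_nonneg ht]
    nlinarith
  · have h2 := Real.add_one_le_exp t
    have h3 : 1 ≤ Real.exp |t| := Real.one_le_exp (abs_nonneg _)
    nlinarith [sq_nonneg t]

/-- The linear term integrates to zero and the remainder separates in `X` and `Y`. The denominator
`32 = 8 * 2²` is that of the sub-Gaussian bound for vectors of norm at most 2. One factor `exp (d X²
/ 64)` absorbs `X²`, another half of `|l X Y|`. -/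
lemma exp_mul_mul_le {d l X Y : ℝ} (hd : 0 < d) (hl : |l| ≤ d / 32) :
    Real.exp (l * X * Y) ≤ 1 + l * X * Y +
      4096 * l ^ 2 / d ^ 2 * (Real.exp (d * X ^ 2 / 32) * Real.exp (d * Y ^ 2 / 32)) := by
  refine (exp_le_one_add_add_sq_mul_exp_abs _).trans (add_le_add le_rfl ?_)
  have hX : ∀ x : ℝ, x ^ 2 ≤ 64 / d * Real.exp (d * x ^ 2 / 64) := fun x => by
    have := Real.add_one_le_exp (d * x ^ 2 / 64)
    rw [div_mul_eq_mul_div, le_div_iff₀ hd]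
    linarith
  have habs : |l * X * Y| ≤ d * X ^ 2 / 64 + d * Y ^ 2 / 64 := by
    rw [mul_assoc, abs_mul, abs_mul]
    have h1 : |X| * |Y| ≤ (X ^ 2 + Y ^ 2) / 2 := by
      nlinarith [sq_nonneg (|X| - |Y|), sq_abs X, sq_abs Y]
    calc |l| * (|X| * |Y|) ≤ d / 32 * ((X ^ 2 + Y ^ 2) / 2) := by gcongr
      _ = _ := by ring
  have he : ∀ x : ℝ, Real.exp (d * x ^ 2 / 32) =
      Real.exp (d * x ^ 2 / 64) * Real.exp (d * x ^ 2 / 64) := fun x => by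
    rw [← Real.exp_add]; ring_nf
  calc (l * X * Y) ^ 2 * Real.exp |l * X * Y|
      ≤ (l * X * Y) ^ 2 * Real.exp (d * X ^ 2 / 64 + d * Y ^ 2 / 64) := by gcongr
    _ = l ^ 2 * (X ^ 2 * Y ^ 2) * (Real.exp (d * X ^ 2 / 64) * Real.exp (d * Y ^ 2 / 64)) := by
        rw [Real.exp_add]; ring
    _ ≤ l ^ 2 * ((64 / d * Real.exp (d * X ^ 2 / 64)) * (64 / d * Real.exp (d * Y ^ 2 / 64))) *
        (Real.exp (d * X ^ 2 / 64) * Real.exp (d * Y ^ 2 / 64)) := by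
        gcongr
        exacts [hX X, hX Y]
    _ = _ := by rw [he, he]; field_simp; norm_num

lemma integral_inner_sphereUniform {d : ℕ} [NeZero d] (z : EuclideanSpace ℝ (Fin d)) :
    ∫ x : UnitSphere d, ⟪x.1, z⟫ ∂(sphereUniform d) = 0 := by
  have h := (measurePreserving_neg_sphereUniform d).integral_comp'
    (f := (Homeomorph.neg (UnitSphere d)).toMeasurableEquiv) (fun x => ⟪x.1, z⟫)
  simp only [Homeomorph.toMeasurableEquiv_coe, Homeomorph.coe_neg, coe_neg_sphere,
    inner_neg_left, integral_neg] at h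
  linarith

lemma integral_exp_mul_inner_le {d : ℕ} [NeZero d] {z : EuclideanSpace ℝ (Fin d)}
    (hz : ‖z‖ ≤ 2) {l X : ℝ} (hl : |l| ≤ d / 32) :
    ∫ y : UnitSphere d, Real.exp (l * X * ⟪y.1, z⟫) ∂(sphereUniform d) ≤
      1 + 12288 * l ^ 2 / d ^ 2 * Real.exp (d * X ^ 2 / 32) := by
  have hd : (0 : ℝ) < d := by exact_mod_cast Nat.pos_of_ne_zero (NeZero.ne d)
  have i1 : Integrable (fun y : UnitSphere d => 1 + l * X * ⟪y.1, z⟫) (sphereUniform d) :=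
    integrable_of_continuous (by fun_prop)
  have i2 : Integrable (fun y : UnitSphere d => 4096 * l ^ 2 / d ^ 2 *
      (Real.exp (d * X ^ 2 / 32) * Real.exp (d * ⟪y.1, z⟫ ^ 2 / 32))) (sphereUniform d) :=
    integrable_of_continuous (by fun_prop)
  have i3 : Integrable (fun y : UnitSphere d => l * X * ⟪y.1, z⟫) (sphereUniform d) :=
    integrable_of_continuous (by fun_prop)
  have h3 := integral_exp_sq_inner_le two_pos hz
  norm_num at h3
  calc _ ≤ ∫ y : UnitSphere d, (1 + l * X * ⟪y.1, z⟫ + 4096 * l ^ 2 / d ^ 2 *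
      (Real.exp (d * X ^ 2 / 32) * Real.exp (d * ⟪y.1, z⟫ ^ 2 / 32))) ∂(sphereUniform d) :=
        integral_mono (integrable_of_continuous (by fun_prop)) (i1.add i2)
          (fun y => exp_mul_mul_le hd hl)
    _ = 1 + 4096 * l ^ 2 / d ^ 2 * (Real.exp (d * X ^ 2 / 32) *
        ∫ y : UnitSphere d, Real.exp (d * ⟪y.1, z⟫ ^ 2 / 32) ∂(sphereUniform d)) := by
        rw [integral_add i1 i2, integral_add (integrable_const _) i3, integral_const_mul,
          integral_const_mul, integral_const_mul, integral_inner_sphereUniform]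
        simp
    _ ≤ 1 + 4096 * l ^ 2 / d ^ 2 * (Real.exp (d * X ^ 2 / 32) * 3) := by gcongr
    _ = _ := by ring

/-- The product of two independent linear functionals on the sphere is sub-exponential. -/
lemma integral_integral_exp_le {d : ℕ} [NeZero d] {z x : EuclideanSpace ℝ (Fin d)}
    (hz : ‖z‖ ≤ 2) (hx : ‖x‖ ≤ 2) {l : ℝ} (hl : |l| ≤ d / 32) :
    ∫ p : UnitSphere d, ∫ y : UnitSphere d, Real.exp (l * ⟪p.1, z⟫ * ⟪y.1, x⟫) ∂(sphereUniform d)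
      ∂(sphereUniform d) ≤ Real.exp (36864 * l ^ 2 / d ^ 2) := by
  have h3 := integral_exp_sq_inner_le two_pos hz
  norm_num at h3
  have i2 : Integrable (fun p : UnitSphere d => 12288 * l ^ 2 / d ^ 2 *
      Real.exp (d * ⟪p.1, z⟫ ^ 2 / 32)) (sphereUniform d) :=
    integrable_of_continuous (by fun_prop)
  calc _ ≤ ∫ p : UnitSphere d, (1 + 12288 * l ^ 2 / d ^ 2 *
        Real.exp (d * ⟪p.1, z⟫ ^ 2 / 32)) ∂(sphereUniform d) :=
        integral_mono_of_nonneg (.of_forall fun p => integral_nonneg fun y => (Real.exp_pos _).le)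
          ((integrable_const _).add i2) (.of_forall fun p => integral_exp_mul_inner_le hx hl)
    _ = 1 + 12288 * l ^ 2 / d ^ 2 *
        ∫ p : UnitSphere d, Real.exp (d * ⟪p.1, z⟫ ^ 2 / 32) ∂(sphereUniform d) := by
        rw [integral_add (integrable_const _) i2, integral_const_mul]
        simp
    _ ≤ 1 + 12288 * l ^ 2 / d ^ 2 * 3 := by gcongr
    _ ≤ Real.exp (36864 * l ^ 2 / d ^ 2) := by
        have := Real.add_one_le_exp (36864 * l ^ 2 / (d : ℝ) ^ 2)
        have e : 12288 * l ^ 2 / (d : ℝ) ^ 2 * 3 = 36864 * l ^ 2 / d ^ 2 := by ring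
        linarith

lemma integral_exp_sum_le {d n : ℕ} [NeZero d] {z x : EuclideanSpace ℝ (Fin d)}
    (hz : ‖z‖ ≤ 2) (hx : ‖x‖ ≤ 2) {l : ℝ} (hl : |l| ≤ d / 32) :
    ∫ ψ : Fin n ⊕ Fin n → UnitSphere d,
      Real.exp (l * ∑ i, ⟪(ψ (.inl i)).1, z⟫ * ⟪(ψ (.inr i)).1, x⟫)
      ∂(Measure.pi fun _ => sphereUniform d) ≤ Real.exp (n * (36864 * l ^ 2 / d ^ 2)) := by
  have hmp := measurePreserving_sumPiEquivProdPi_symm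
    (fun _ : Fin n ⊕ Fin n => sphereUniform d)
  rw [← hmp.integral_comp']
  have hc : Continuous fun p : (Fin n → UnitSphere d) × (Fin n → UnitSphere d) =>
      Real.exp (l * ∑ i, ⟪(p.1 i).1, z⟫ * ⟪(p.2 i).1, x⟫) := by fun_prop
  have hi := hc.integrable_of_hasCompactSupport (HasCompactSupport.of_compactSpace _)
    (μ := (Measure.pi fun _ : Fin n => sphereUniform d).prod
      (Measure.pi fun _ : Fin n => sphereUniform d))
  have e1 := integral_prod _ hi
  have e2 : ∀ p r : Fin n → UnitSphere d, Real.exp (l * ∑ i, ⟪(p i).1, z⟫ * ⟪(r i).1, x⟫) =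
      ∏ i, Real.exp (l * ⟪(p i).1, z⟫ * ⟪(r i).1, x⟫) := fun p r => by
    rw [← Real.exp_sum, Finset.mul_sum]
    simp only [mul_assoc]
  have e3 : ∀ p : Fin n → UnitSphere d,
      ∫ r, ∏ i, Real.exp (l * ⟪(p i).1, z⟫ * ⟪(r i).1, x⟫)
        ∂(Measure.pi fun _ : Fin n => sphereUniform d) =
      ∏ i, ∫ y : UnitSphere d, Real.exp (l * ⟪(p i).1, z⟫ * ⟪y.1, x⟫) ∂(sphereUniform d) :=
    fun p => integral_fintype_prod_eq_prod
      (fun i (y : UnitSphere d) => Real.exp (l * ⟪(p i).1, z⟫ * ⟪y.1, x⟫))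
  have e4 := integral_fintype_prod_eq_prod (μ := fun _ : Fin n => sphereUniform d)
      (fun (_ : Fin n) (p : UnitSphere d) =>
        ∫ y : UnitSphere d, Real.exp (l * ⟪p.1, z⟫ * ⟪y.1, x⟫) ∂(sphereUniform d))
  refine (e1.trans ?_).trans_le (?_ : ∏ _i : Fin n, ∫ p : UnitSphere d, ∫ y : UnitSphere d,
    Real.exp (l * ⟪p.1, z⟫ * ⟪y.1, x⟫) ∂(sphereUniform d) ∂(sphereUniform d) ≤ _)
  · simp only [e2, e3]
    exact e4
  · rw [Finset.prod_const, Finset.card_univ, Fintype.card_fin, Real.exp_nat_mul]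
    gcongr
    exact integral_integral_exp_le hz hx hl

/-- The joint law of a subfamily of independent uniform codes. -/
lemma measurePreserving_pi_precomp {d : ℕ} [NeZero d] {ι κ : Type*} [Fintype ι] [Fintype κ]
    {e : κ → ι} (he : Function.Injective e) :
    MeasurePreserving (fun (ψ : ι → UnitSphere d) k => ψ (e k))
      (Measure.pi fun _ => sphereUniform d) (Measure.pi fun _ => sphereUniform d) := by
  refine ⟨by fun_prop, ?_⟩
  have h := (iIndepFun_pi (μ := fun _ : ι => sphereUniform d) (X := fun _ => id)
    (fun _ => aemeasurable_id)).precomp he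
  refine (h.map_fun_eq_pi_map fun k => (measurable_pi_apply _).aemeasurable).trans ?_
  congr 1
  ext1 k
  exact (measurePreserving_eval (fun _ : ι => sphereUniform d) (e k)).map_eq

/-- Chernoff's bound: as the `q i` and `r i` are distinct, the exponential moment factors over `i`.
-/
lemma measure_sum_inner_ge_le {d n : ℕ} [NeZero d] {ι : Type*} [Fintype ι] {q r : Fin n → ι}
    (hqr : Function.Injective (Sum.elim q r)) {z x : EuclideanSpace ℝ (Fin d)}
    (hz : ‖z‖ ≤ 2) (hx : ‖x‖ ≤ 2) {l : ℝ} (hl0 : 0 ≤ l) (hl : l ≤ d / 32) (t : ℝ) :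
    (Measure.pi fun _ : ι => sphereUniform d)
      {ψ | t ≤ ∑ i, ⟪(ψ (q i)).1, z⟫ * ⟪(ψ (r i)).1, x⟫} ≤
      ENNReal.ofReal (Real.exp (-l * t + n * (36864 * l ^ 2 / d ^ 2))) := by
  have hc : Continuous fun ψ : Fin n ⊕ Fin n → UnitSphere d =>
      ∑ i, ⟪(ψ (.inl i)).1, z⟫ * ⟪(ψ (.inr i)).1, x⟫ := by fun_prop
  have hmp := measurePreserving_pi_precomp (d := d) hqr
  have hS : MeasurableSet {ψ : Fin n ⊕ Fin n → UnitSphere d |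
      t ≤ ∑ i, ⟪(ψ (.inl i)).1, z⟫ * ⟪(ψ (.inr i)).1, x⟫} :=
    (isClosed_le continuous_const hc).measurableSet
  have e := hmp.measure_preimage hS.nullMeasurableSet
  refine (le_of_eq e).trans ?_
  rw [← ENNReal.ofReal_toReal (measure_ne_top (Measure.pi fun _ => sphereUniform d) _)]
  refine ENNReal.ofReal_le_ofReal ?_
  have hce := hc.const_mul l |>.rexp
  refine (measure_ge_le_exp_mul_mgf t hl0
    (hce.integrable_of_hasCompactSupport (HasCompactSupport.of_compactSpace _))).trans ?_
  rw [Real.exp_add]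
  gcongr
  exact integral_exp_sum_le hz hx (by rwa [abs_of_nonneg hl0])

/-! ### The operator norm of the nuisance matrix. -/

/-- The operator `∑ i, qᵢ rᵢᵀ`. -/
noncomputable def nuisance {d n : ℕ} (q r : Fin n → EuclideanSpace ℝ (Fin d)) :
    EuclideanSpace ℝ (Fin d) →L[ℝ] EuclideanSpace ℝ (Fin d) :=
  ∑ i, (innerSL ℝ (r i)).smulRight (q i)

lemma nuisance_apply {d n : ℕ} (q r : Fin n → EuclideanSpace ℝ (Fin d))
    (x : EuclideanSpace ℝ (Fin d)) : nuisance q r x = ∑ i, ⟪r i, x⟫ • q i := by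
  simp [nuisance]

lemma inner_nuisance {d n : ℕ} (q r : Fin n → EuclideanSpace ℝ (Fin d))
    (x z : EuclideanSpace ℝ (Fin d)) : ⟪nuisance q r x, z⟫ = ∑ i, ⟪q i, z⟫ * ⟪r i, x⟫ := by
  rw [nuisance_apply, sum_inner]
  exact Finset.sum_congr rfl fun i _ => by rw [real_inner_smul_left, mul_comm]

/-- An operator of large norm has a large bilinear form on a product of two balls. -/
lemma exists_ball_le_inner {E : Type*} [NormedAddCommGroup E] [InnerProductSpace ℝ E]
    (A : E →L[ℝ] E) {s : ℝ} (hs : 0 ≤ s) (h : s < ‖A‖) :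
    ∃ z₀ x₀ : E, ‖z₀‖ ≤ 1 ∧ ‖x₀‖ ≤ 1 ∧ ∀ z ∈ Metric.ball z₀ (1 / 4), ∀ x ∈ Metric.ball x₀ (1 / 4),
      s / 4 ≤ ⟪A x, z⟫ := by
  have ha : 0 < ‖A‖ := hs.trans_lt h
  obtain ⟨x₀, hx₀, hA⟩ := A.exists_lt_apply_of_lt_opNorm (r := 9 / 10 * ‖A‖) (by linarith)
  have hAx : 0 < ‖A x₀‖ := lt_trans (by positivity) hA
  refine ⟨(‖A x₀‖)⁻¹ • A x₀, x₀, ?_, hx₀.le, fun z hz x hx => ?_⟩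
  · rw [norm_smul, norm_inv, norm_norm, inv_mul_cancel₀ hAx.ne']
  set z₀ := (‖A x₀‖)⁻¹ • A x₀ with hz₀
  have hz₀n : ‖z₀‖ = 1 := by rw [norm_smul, norm_inv, norm_norm, inv_mul_cancel₀ hAx.ne']
  rw [mem_ball_iff_norm] at hz hx
  have hin : ⟪A x₀, z₀⟫ = ‖A x₀‖ := by
    rw [hz₀, real_inner_smul_right, real_inner_self_eq_norm_sq]
    field_simp
  have hzn : ‖z‖ ≤ 5 / 4 := by
    calc ‖z‖ = ‖z₀ + (z - z₀)‖ := by rw [add_sub_cancel]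
      _ ≤ ‖z₀‖ + ‖z - z₀‖ := norm_add_le _ _
      _ ≤ 5 / 4 := by linarith
  have e : ⟪A x, z⟫ = ⟪A x₀, z₀⟫ + ⟪A x₀, z - z₀⟫ + ⟪A (x - x₀), z⟫ := by
    rw [map_sub, inner_sub_left, inner_sub_right]; ring
  have hAx1 : ‖A x₀‖ ≤ ‖A‖ := (A.le_opNorm x₀).trans (mul_le_of_le_one_right ha.le hx₀.le)
  have b1 : |⟪A x₀, z - z₀⟫| ≤ ‖A‖ * (1 / 4) :=
    (abs_real_inner_le_norm _ _).trans (mul_le_mul hAx1 hz.le (norm_nonneg _) ha.le)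
  have b2 : |⟪A (x - x₀), z⟫| ≤ ‖A‖ * (1 / 4) * (5 / 4) := by
    refine (abs_real_inner_le_norm _ _).trans (mul_le_mul ?_ hzn (norm_nonneg _) (by positivity))
    exact (A.le_opNorm _).trans (mul_le_mul_of_nonneg_left hx.le ha.le)
  have := neg_le_of_abs_le b1
  have := neg_le_of_abs_le b2
  rw [e, hin]
  -- The constants fit: `9/10 - 1/4 - 5/16 > 1/4`.
  linarith

/-- Fubini on configurations times pairs `(z, x)` in balls of radius 2. A bad configuration
contributes at least the volume of two balls of radius `1/4`, while each pair contributes at most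
`p`; the volume ratio is `(2 / (1/4)) ^ (2d) = 64 ^ d`. -/
lemma measure_norm_nuisance_gt_le_of_tail {d n : ℕ} [NeZero d] {ι : Type*} [Fintype ι]
    (q r : Fin n → ι) {s : ℝ} (hs : 0 ≤ s) {p : ℝ≥0∞}
    (hp : ∀ z x : EuclideanSpace ℝ (Fin d), ‖z‖ ≤ 2 → ‖x‖ ≤ 2 →
      (Measure.pi fun _ : ι => sphereUniform d)
        {ψ | s / 4 ≤ ∑ i, ⟪(ψ (q i)).1, z⟫ * ⟪(ψ (r i)).1, x⟫} ≤ p) :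
    (Measure.pi fun _ : ι => sphereUniform d)
      {ψ | s < ‖nuisance (fun i => (ψ (q i)).1) (fun i => (ψ (r i)).1)‖} ≤
      ENNReal.ofReal (64 ^ d) * p := by
  set E := EuclideanSpace ℝ (Fin d)
  set π := (Measure.pi fun _ : ι => sphereUniform d)
  set b : ℝ≥0∞ := volume (Metric.ball (0 : E) 1) with hb
  have hb0 : b ≠ 0 := (Metric.measure_ball_pos _ _ one_pos).ne'
  have hbt : b ≠ ⊤ := measure_ball_lt_top.ne
  set B := Metric.ball (0 : E) 2 ×ˢ Metric.ball (0 : E) 2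
  set ν : Measure (E × E) := (volume.prod volume).restrict B with hν
  have hνu : ν Set.univ = ENNReal.ofReal (4 ^ d) * b ^ 2 := by
    rw [hν, Measure.restrict_apply_univ, Measure.prod_prod,
      Measure.addHaar_ball _ _ (by norm_num : (0 : ℝ) ≤ 2), finrank_euclideanSpace_fin,
      show (4 : ℝ) ^ d = 2 ^ d * 2 ^ d by rw [← mul_pow]; norm_num,
      ENNReal.ofReal_mul (by positivity)]
    ring
  set S : Set ((ι → UnitSphere d) × (E × E)) :=
    {y | s / 4 ≤ ∑ i, ⟪(y.1 (q i)).1, y.2.1⟫ * ⟪(y.1 (r i)).1, y.2.2⟫} with hS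
  have hSm : MeasurableSet S :=
    (isClosed_le continuous_const (by fun_prop)).measurableSet
  have upper : (π.prod ν) S ≤ p * (ENNReal.ofReal (4 ^ d) * b ^ 2) := by
    rw [Measure.prod_apply_symm hSm, ← hνu, ← lintegral_const]
    refine lintegral_mono_ae ?_
    filter_upwards [ae_restrict_mem (measurableSet_ball.prod measurableSet_ball)] with y hy
    exact hp y.1 y.2 (mem_ball_zero_iff.1 hy.1).le (mem_ball_zero_iff.1 hy.2).le
  have lower : ENNReal.ofReal ((1 / 16) ^ d) * b ^ 2 *
      π {ψ | s < ‖nuisance (fun i => (ψ (q i)).1) (fun i => (ψ (r i)).1)‖} ≤ (π.prod ν) S := by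
    rw [Measure.prod_apply hSm]
    refine le_trans ?_ (mul_meas_ge_le_lintegral (measurable_measure_prodMk_left hSm)
      (ENNReal.ofReal ((1 / 16) ^ d) * b ^ 2))
    gcongr with ψ
    intro hψ
    obtain ⟨z₀, x₀, hz₀, hx₀, h⟩ := exists_ball_le_inner _ hs hψ
    have hsub : Metric.ball z₀ (1 / 4) ×ˢ Metric.ball x₀ (1 / 4) ⊆ (Prod.mk ψ ⁻¹' S) ∩ B := by
      rintro ⟨z, x⟩ ⟨hz, hx⟩
      refine ⟨?_, ?_, ?_⟩
      · have := h z hz x hx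
        rwa [inner_nuisance] at this
      · exact Metric.ball_subset_ball' (by rw [dist_zero_right]; linarith) hz
      · exact Metric.ball_subset_ball' (by rw [dist_zero_right]; linarith) hx
    rw [hν, Measure.restrict_apply (measurable_prodMk_left hSm)]
    refine le_trans (le_of_eq ?_) (measure_mono hsub)
    rw [Measure.prod_prod,
      Measure.addHaar_ball _ _ (by norm_num : (0 : ℝ) ≤ 1 / 4),
      Measure.addHaar_ball _ _ (by norm_num : (0 : ℝ) ≤ 1 / 4), finrank_euclideanSpace_fin,
      show (1 / 16 : ℝ) ^ d = (1 / 4) ^ d * (1 / 4) ^ d by rw [← mul_pow]; norm_num,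
      ENNReal.ofReal_mul (by positivity)]
    ring
  have h := lower.trans upper
  have e : p * (ENNReal.ofReal (4 ^ d) * b ^ 2) =
      ENNReal.ofReal ((1 / 16) ^ d) * b ^ 2 * (ENNReal.ofReal (64 ^ d) * p) := by
    rw [show (4 : ℝ) ^ d = (1 / 16) ^ d * 64 ^ d by rw [← mul_pow]; norm_num,
      ENNReal.ofReal_mul (by positivity)]
    ring
  rw [e] at h
  refine (ENNReal.mul_le_mul_iff_right ?_ ?_).1 h
  · refine mul_ne_zero ?_ (pow_ne_zero _ hb0)
    rw [Ne, ENNReal.ofReal_eq_zero, not_le]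
    positivity
  · exact ENNReal.mul_ne_top ENNReal.ofReal_ne_top (ENNReal.pow_ne_top hbt)

/-- With overwhelming probability, the nuisance operator has norm `O(1 + √(n/d))`. -/
lemma measure_norm_nuisance_gt_le {d n : ℕ} [NeZero d] {ι : Type*} [Fintype ι] {q r : Fin n → ι}
    (hqr : Function.Injective (Sum.elim q r)) {m : ℝ} (hm : 1 ≤ m) (hn : n ≤ d * m ^ 2) :
    (Measure.pi fun _ : ι => sphereUniform d)
      {ψ | 5376 * m < ‖nuisance (fun i => (ψ (q i)).1) (fun i => (ψ (r i)).1)‖} ≤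
      ENNReal.ofReal (Real.exp (-d)) := by
  have hd : (0 : ℝ) < d := by exact_mod_cast Nat.pos_of_ne_zero (NeZero.ne d)
  have hm0 : 0 < m := by linarith
  -- Chernoff parameter `l = d / (32 m)`. The exponents are `-42 d` from the threshold, `36 d` from
  -- the moment and `5 d` from `64 ≤ e⁵`, in total `-d`.
  have hl : (d : ℝ) / (32 * m) ≤ d / 32 := by gcongr; linarith
  refine (measure_norm_nuisance_gt_le_of_tail q r (by positivity) fun z x hz hx =>
    measure_sum_inner_ge_le hqr hz hx (by positivity) hl _).trans ?_
  rw [← ENNReal.ofReal_mul (by positivity)]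
  refine ENNReal.ofReal_le_ofReal ?_
  have h64 : (64 : ℝ) ^ d ≤ Real.exp (d * 5) := by
    rw [Real.exp_nat_mul]
    gcongr
    rw [show (5 : ℝ) = (5 : ℕ) * 1 by norm_num, Real.exp_nat_mul]
    have := Real.exp_one_gt_d9
    calc (64 : ℝ) ≤ 2.7 ^ 5 := by norm_num
      _ ≤ _ := by gcongr; linarith
  refine (mul_le_mul_of_nonneg_right h64 (Real.exp_pos _).le).trans ?_
  rw [← Real.exp_add]
  refine Real.exp_le_exp.2 ?_
  have e1 : -((d : ℝ) / (32 * m)) * (5376 * m / 4) = -(42 * d) := by field_simp; ring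
  have e2 : (n : ℝ) * (36864 * (d / (32 * m)) ^ 2 / d ^ 2) ≤ 36 * d := by
    have : (n : ℝ) * (36864 * (d / (32 * m)) ^ 2 / d ^ 2) = 36 * (n / m ^ 2) := by
      field_simp; ring
    rw [this]
    gcongr
    rwa [div_le_iff₀ (by positivity)]
  rw [e1]
  linarith

/-! ### Near-orthogonality of a code to vectors independent of it. -/

/-- If every section of `S` in the `i`-th coordinate has measure at most `p`, then so has `S`. -/
lemma measure_pi_le_of_section {ι : Type*} [Fintype ι] [DecidableEq ι] {X : ι → Type*}
    [∀ i, MeasurableSpace (X i)] (μ : ∀ i, Measure (X i)) [∀ i, IsProbabilityMeasure (μ i)]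
    {S : Set (∀ i, X i)} (hS : MeasurableSet S) (i : ι) {p : ℝ≥0∞}
    (h : ∀ ψ, μ i {x | Function.update ψ i x ∈ S} ≤ p) : Measure.pi μ S ≤ p := by
  have : ∀ i, Nonempty (X i) := fun i => (μ i).nonempty_of_neZero
  have hf : Measurable (S.indicator (fun _ => (1 : ℝ≥0∞))) := measurable_const.indicator hS
  have key : (∫⋯∫⁻_{i}, S.indicator (fun _ => (1 : ℝ≥0∞)) ∂μ) ≤
      (∫⋯∫⁻_{i}, (fun _ => p) ∂μ) := by
    intro ψ
    rw [lmarginal_singleton, lmarginal_singleton]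
    simp only [lintegral_const, measure_univ, mul_one]
    refine le_trans (le_of_eq ?_) (h ψ)
    exact lintegral_indicator_one (measurable_update ψ hS)
  have h2 := lintegral_le_of_lmarginal_le {i} hf measurable_const key
  simpa [lintegral_indicator hS] using h2

/-- A code is nearly orthogonal to any bounded vector which does not depend on it. -/
lemma measure_abs_inner_ge_le {d : ℕ} [NeZero d] {ι : Type*} [Fintype ι] [DecidableEq ι] (i : ι)
    {g : (ι → UnitSphere d) → EuclideanSpace ℝ (Fin d)} (hg : Continuous g)
    (hi : ∀ ψ x, g (Function.update ψ i x) = g ψ) {L t : ℝ} (hL : 0 < L) (ht : 0 ≤ t) :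
    (Measure.pi fun _ : ι => sphereUniform d) {ψ | t ≤ |⟪(ψ i).1, g ψ⟫| ∧ ‖g ψ‖ ≤ L} ≤
      ENNReal.ofReal (2 * Real.exp (-(d * t ^ 2 / (4 * L ^ 2)))) := by
  refine measure_pi_le_of_section _ ?_ i fun ψ => ?_
  · have h1 : Continuous fun ψ : ι → UnitSphere d => |⟪(ψ i).1, g ψ⟫| := by fun_prop
    exact ((isClosed_le continuous_const h1).inter
      (isClosed_le hg.norm continuous_const)).measurableSet
  · simp only [Set.mem_ofPred_eq, Function.update_self, hi]
    -- Along a section `g` is constant, so the section is a two-sided cap or empty. Keeping the norm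
    -- bound inside the event avoids conditioning.
    by_cases h : ‖g ψ‖ ≤ L
    · simpa [h] using sphereUniform_abs_inner_ge_le hL h ht
    · simp [h]

/-! ### Deterministic estimates for the scores. -/

/-- The operator `u vᵀ + v wᵀ + N`. -/
noncomputable def edgeOp {d : ℕ} (u v w : EuclideanSpace ℝ (Fin d))
    (N : EuclideanSpace ℝ (Fin d) →L[ℝ] EuclideanSpace ℝ (Fin d)) :
    EuclideanSpace ℝ (Fin d) →L[ℝ] EuclideanSpace ℝ (Fin d) :=
  (innerSL ℝ v).smulRight u + (innerSL ℝ w).smulRight v + N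

lemma edgeOp_apply {d : ℕ} (u v w x : EuclideanSpace ℝ (Fin d))
    (N : EuclideanSpace ℝ (Fin d) →L[ℝ] EuclideanSpace ℝ (Fin d)) :
    edgeOp u v w N x = ⟪v, x⟫ • u + ⟪w, x⟫ • v + N x := by
  simp [edgeOp]

lemma norm_edgeOp_le {d : ℕ} {u v w : EuclideanSpace ℝ (Fin d)} (hu : ‖u‖ = 1) (hv : ‖v‖ = 1)
    (hw : ‖w‖ = 1) (N : EuclideanSpace ℝ (Fin d) →L[ℝ] EuclideanSpace ℝ (Fin d)) :
    ‖edgeOp u v w N‖ ≤ ‖N‖ + 2 := by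
  have h := norm_add₃_le (a := (innerSL ℝ v).smulRight u) (b := (innerSL ℝ w).smulRight v) (c := N)
  rw [ContinuousLinearMap.norm_smulRight_apply, ContinuousLinearMap.norm_smulRight_apply,
    innerSL_apply_norm, innerSL_apply_norm, hu, hv, hw] at h
  calc ‖edgeOp u v w N‖ ≤ _ := h
    _ = _ := by ring

/-- The query score of the composed edge. -/
lemma inner_edgeOp_edgeOp {d : ℕ} {u v w : EuclideanSpace ℝ (Fin d)} (hu : ‖u‖ = 1)
    (hv : ‖v‖ = 1) (hw : ‖w‖ = 1)
    (N : EuclideanSpace ℝ (Fin d) →L[ℝ] EuclideanSpace ℝ (Fin d)) :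
    ⟪u, edgeOp u v w N (edgeOp u v w N w)⟫ =
      1 + 2 * (⟪u, v⟫ * ⟪v, w⟫) + ⟪u, v⟫ * ⟪v, w⟫ * ⟪w, u⟫ + ⟪v, N w⟫ + ⟪u, N v⟫ +
        ⟪u, v⟫ * ⟪w, N w⟫ + ⟪v, w⟫ * ⟪u, N u⟫ + ⟪u, N (N w)⟫ := by
  have hu' : ⟪u, u⟫ = 1 := by rw [real_inner_self_eq_norm_sq, hu, one_pow]
  have hv' : ⟪v, v⟫ = 1 := by rw [real_inner_self_eq_norm_sq, hv, one_pow]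
  have hw' : ⟪w, w⟫ = 1 := by rw [real_inner_self_eq_norm_sq, hw, one_pow]
  simp only [edgeOp_apply, inner_add_right, real_inner_smul_right, map_add, map_smul, hu', hv', hw',
    real_inner_comm v u, real_inner_comm w v]
  ring

/-- In each term of the expansion one factor that will be small is kept, and the others are bounded
by `1` or `‖N‖`. -/
lemma abs_inner_edgeOp_edgeOp_sub_one_le {d : ℕ} {u v w : EuclideanSpace ℝ (Fin d)}
    (hu : ‖u‖ = 1) (hv : ‖v‖ = 1) (hw : ‖w‖ = 1)
    (N : EuclideanSpace ℝ (Fin d) →L[ℝ] EuclideanSpace ℝ (Fin d)) :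
    |⟪u, edgeOp u v w N (edgeOp u v w N w)⟫ - 1| ≤
      (3 + ‖N‖) * |⟪u, v⟫| + ‖N‖ * |⟪v, w⟫| + |⟪v, N w⟫| + |⟪u, N v⟫| + |⟪u, N (N w)⟫| := by
  have hvw : |⟪v, w⟫| ≤ 1 := by simpa [hv, hw] using abs_real_inner_le_norm v w
  have hwu : |⟪w, u⟫| ≤ 1 := by simpa [hu, hw] using abs_real_inner_le_norm w u
  have hN : ∀ x : EuclideanSpace ℝ (Fin d), ‖x‖ = 1 → |⟪x, N x⟫| ≤ ‖N‖ := fun x hx => by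
    have h1 := abs_real_inner_le_norm x (N x)
    have h2 := N.le_opNorm x
    rw [hx, one_mul] at h1
    rw [hx, mul_one] at h2
    exact h1.trans h2
  have e1 : |2 * (⟪u, v⟫ * ⟪v, w⟫)| ≤ 2 * |⟪u, v⟫| := by
    rw [abs_mul, abs_mul, abs_two]
    gcongr
    exact mul_le_of_le_one_right (abs_nonneg _) hvw
  have e2 : |⟪u, v⟫ * ⟪v, w⟫ * ⟪w, u⟫| ≤ |⟪u, v⟫| := by
    rw [abs_mul, abs_mul, mul_assoc]
    exact mul_le_of_le_one_right (abs_nonneg _) (mul_le_one₀ hvw (abs_nonneg _) hwu)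
  have e3 : |⟪u, v⟫ * ⟪w, N w⟫| ≤ ‖N‖ * |⟪u, v⟫| := by
    rw [abs_mul, mul_comm]; gcongr; exact hN w hw
  have e4 : |⟪v, w⟫ * ⟪u, N u⟫| ≤ ‖N‖ * |⟪v, w⟫| := by
    rw [abs_mul, mul_comm]; gcongr; exact hN u hu
  rw [inner_edgeOp_edgeOp hu hv hw, abs_le]
  rw [abs_le] at e1 e2 e3 e4
  constructor <;>
    linarith [neg_abs_le ⟪v, N w⟫, neg_abs_le ⟪u, N v⟫, neg_abs_le ⟪u, N (N w)⟫,
      le_abs_self ⟪v, N w⟫, le_abs_self ⟪u, N v⟫, le_abs_self ⟪u, N (N w)⟫]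

/-- The nuisance operator of a family of codes. -/
noncomputable abbrev codeNuisance {ι : Type*} {d n : ℕ} (ψ : ι → UnitSphere d) (q r : Fin n → ι) :
    EuclideanSpace ℝ (Fin d) →L[ℝ] EuclideanSpace ℝ (Fin d) :=
  nuisance (fun i => (ψ (q i)).1) (fun i => (ψ (r i)).1)

lemma continuous_innerSL_smulRight {α E : Type*} [TopologicalSpace α] [NormedAddCommGroup E]
    [InnerProductSpace ℝ E] {f g : α → E} (hf : Continuous f) (hg : Continuous g) :
    Continuous fun a => (innerSL ℝ (f a)).smulRight (g a) :=
  ((ContinuousLinearMap.smulRightL ℝ E E).continuous.comp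
    ((innerSL ℝ).continuous.comp hf)).clm_apply hg

lemma continuous_codeNuisance {ι : Type*} {d n : ℕ} (q r : Fin n → ι) :
    Continuous fun ψ : ι → UnitSphere d => codeNuisance ψ q r := by
  unfold codeNuisance nuisance
  exact continuous_finsetSum _ fun i _ => continuous_innerSL_smulRight (by fun_prop) (by fun_prop)

lemma continuous_edgeOp {ι : Type*} {d n : ℕ} (u v w : ι) (q r : Fin n → ι) :
    Continuous fun ψ : ι → UnitSphere d =>
      edgeOp (ψ u).1 (ψ v).1 (ψ w).1 (codeNuisance ψ q r) := by
  unfold edgeOp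
  exact ((continuous_innerSL_smulRight (by fun_prop) (by fun_prop)).add
    (continuous_innerSL_smulRight (by fun_prop) (by fun_prop))).add (continuous_codeNuisance q r)

lemma composedScore_eq {ι : Type*} {d n : ℕ} (ψ : ι → UnitSphere d) (u v w : ι) (q r : Fin n → ι)
    (x y : ι) :
    composedScore ψ u v w q r x y =
      ⟪(ψ x).1, edgeOp (ψ u).1 (ψ v).1 (ψ w).1 (codeNuisance ψ q r)
        (edgeOp (ψ u).1 (ψ v).1 (ψ w).1 (codeNuisance ψ q r) (ψ y).1)⟫ := by
  have hb : ∀ (s t : UnitSphere d) (z : EuclideanSpace ℝ (Fin d)),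
      Matrix.mulVec (bind s t) z.ofLp = (⟪t.1, z⟫ • s.1).ofLp := fun s t z => by
    rw [bind, Matrix.vecMulVec_mulVec, EuclideanSpace.inner_eq_star_dotProduct, dotProduct_comm]
    simp
  have h : ∀ z : EuclideanSpace ℝ (Fin d), Matrix.mulVec (graphEmbedding ψ u v w q r) z.ofLp =
      (edgeOp (ψ u).1 (ψ v).1 (ψ w).1 (codeNuisance ψ q r) z).ofLp := fun z => by
    rw [graphEmbedding, Matrix.add_mulVec, Matrix.add_mulVec, Matrix.sum_mulVec, edgeOp_apply,
      nuisance_apply]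
    simp only [hb, WithLp.ofLp_add, WithLp.ofLp_sum]
  rw [composedScore, edgeQuery, pow_two, ← Matrix.mulVec_mulVec, h, h,
    EuclideanSpace.inner_eq_star_dotProduct, dotProduct_comm]
  simp

lemma norm_apply_apply_le {E : Type*} [NormedAddCommGroup E] [NormedSpace ℝ E] (A : E →L[ℝ] E)
    {c : ℝ} (hA : ‖A‖ ≤ c) {x : E} (hx : ‖x‖ = 1) : ‖A (A x)‖ ≤ c ^ 2 := by
  have h1 := A.le_of_opNorm_le hA (A x)
  have h2 := A.le_of_opNorm_le hA x
  have h0 : 0 ≤ c := (norm_nonneg _).trans hA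
  rw [hx, mul_one] at h2
  calc _ ≤ c * c := h1.trans (mul_le_mul_of_nonneg_left h2 h0)
    _ = c ^ 2 := (pow_two c).symm

/-- Off a union of small events, the true score exceeds the spurious one. -/
lemma score_lt_score {d : ℕ} {u v w a b : EuclideanSpace ℝ (Fin d)} (hu : ‖u‖ = 1) (hv : ‖v‖ = 1)
    (hw : ‖w‖ = 1) (hb : ‖b‖ = 1)
    {N : EuclideanSpace ℝ (Fin d) →L[ℝ] EuclideanSpace ℝ (Fin d)} {l : ℝ} (hl : 1 ≤ l)
    (hN : ‖N‖ ≤ l) {L : ℝ} (hL : (l + 2) ^ 2 ≤ L)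
    (h1 : ¬ (1 / 16 ≤ |⟪u, L • v⟫| ∧ ‖L • v‖ ≤ L)) (h2 : ¬ (1 / 16 ≤ |⟪w, L • v⟫| ∧ ‖L • v‖ ≤ L))
    (h3 : ¬ (1 / 16 ≤ |⟪v, N w⟫| ∧ ‖N w‖ ≤ L)) (h4 : ¬ (1 / 16 ≤ |⟪u, N v⟫| ∧ ‖N v‖ ≤ L))
    (h5 : ¬ (1 / 16 ≤ |⟪u, N (N w)⟫| ∧ ‖N (N w)‖ ≤ L))
    (h6 : ¬ (1 / 16 ≤ |⟪a, edgeOp u v w N (edgeOp u v w N b)⟫| ∧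
      ‖edgeOp u v w N (edgeOp u v w N b)‖ ≤ L)) :
    ⟪a, edgeOp u v w N (edgeOp u v w N b)⟫ < ⟪u, edgeOp u v w N (edgeOp u v w N w)⟫ := by
  have hL0 : 0 < L := by nlinarith
  have hlL : l ≤ L := by nlinarith
  have hlL3 : 3 + l ≤ L := by nlinarith
  have hl2 : l ^ 2 ≤ L := by nlinarith
  have hLv : ‖L • v‖ ≤ L := by rw [norm_smul, hv, mul_one, Real.norm_of_nonneg hL0.le]
  have hN1 : ∀ x : EuclideanSpace ℝ (Fin d), ‖x‖ = 1 → ‖N x‖ ≤ L := fun x hx => by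
    have := N.le_of_opNorm_le hN x
    rw [hx, mul_one] at this
    exact this.trans hlL
  have hG : ‖edgeOp u v w N‖ ≤ l + 2 := (norm_edgeOp_le hu hv hw N).trans (by linarith)
  simp only [hLv, hN1 w hw, hN1 v hv, (norm_apply_apply_le N hN hw).trans hl2,
    (norm_apply_apply_le _ hG hb).trans hL, and_true, not_le, real_inner_smul_right, abs_mul,
    abs_of_pos hL0] at h1 h2 h3 h4 h5 h6
  have hT := abs_inner_edgeOp_edgeOp_sub_one_le hu hv hw N
  rw [real_inner_comm] at h2
  -- The vector was scaled to `L • v` so that `L * |⟪u, v⟫|` and `L * |⟪v, w⟫|` are below `1/16`.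
  -- Five such errors leave a true score above `11/16`, against a spurious score below `1/16`.
  have b1 : (3 + ‖N‖) * |⟪u, v⟫| ≤ L * |⟪u, v⟫| := by gcongr; linarith
  have b2 : ‖N‖ * |⟪v, w⟫| ≤ L * |⟪v, w⟫| := by gcongr; linarith
  have hT' := neg_le_of_abs_le hT
  have hF := le_abs_self ⟪a, edgeOp u v w N (edgeOp u v w N b)⟫
  linarith

/-! ### Large deviations for one spurious edge. -/

/-- The probability that a spurious score is at least the true score: large deviations. -/
lemma measure_score_le_score_le {d n : ℕ} [NeZero d] {ι : Type*} [Fintype ι]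
    {u v w a b : ι} {q r : Fin n → ι} (hinj : Function.Injective (graphVertex u v w q r))
    (ha : a ∉ Set.range (graphVertex u v w q r)) (hab : a ≠ b) {m : ℝ} (hm : 1 ≤ m)
    (hn : n ≤ d * m ^ 2) :
    (Measure.pi fun _ : ι => sphereUniform d)
      {ψ | composedScore ψ u v w q r u w ≤ composedScore ψ u v w q r a b} ≤
      ENNReal.ofReal (13 * Real.exp (-(d / (1024 * 5378 ^ 4 * m ^ 4)))) := by
  classical
  have hne : ∀ i j, i ≠ j → graphVertex u v w q r i ≠ graphVertex u v w q r j :=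
    fun i j h => hinj.ne h
  have huv : u ≠ v := hne (.inl 0) (.inl 1) (by simp)
  have huw : u ≠ w := hne (.inl 0) (.inl 2) (by simp)
  have hvw : v ≠ w := hne (.inl 1) (.inl 2) (by simp)
  have hqu : ∀ i, q i ≠ u := fun i => hne (.inr (.inl i)) (.inl 0) (by simp)
  have hru : ∀ i, r i ≠ u := fun i => hne (.inr (.inr i)) (.inl 0) (by simp)
  have hqv : ∀ i, q i ≠ v := fun i => hne (.inr (.inl i)) (.inl 1) (by simp)
  have hrv : ∀ i, r i ≠ v := fun i => hne (.inr (.inr i)) (.inl 1) (by simp)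
  have hau : u ≠ a := fun h => ha ⟨.inl 0, h⟩
  have hav : v ≠ a := fun h => ha ⟨.inl 1, h⟩
  have haw : w ≠ a := fun h => ha ⟨.inl 2, h⟩
  have hqa : ∀ i, q i ≠ a := fun i h => ha ⟨.inr (.inl i), h⟩
  have hra : ∀ i, r i ≠ a := fun i h => ha ⟨.inr (.inr i), h⟩
  have hqr : Function.Injective (Sum.elim q r) := hinj.comp Sum.inr_injective
  set L : ℝ := (5376 * m + 2) ^ 2 with hL
  have hL0 : 0 < L := by positivity
  have hm0 : 0 < m := by linarith
  have cN := continuous_codeNuisance (d := d) q r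
  have cG := continuous_edgeOp (d := d) u v w q r
  have cv : ∀ i : ι, Continuous fun ψ : ι → UnitSphere d => (ψ i).1 := fun i => by fun_prop
  have t0 : (0 : ℝ) ≤ 1 / 16 := by norm_num
  have E1 := measure_abs_inner_ge_le (d := d) u (g := fun ψ => L • (ψ v).1) (by fun_prop)
    (fun ψ x => by simp [huv.symm]) hL0 t0
  have E2 := measure_abs_inner_ge_le (d := d) w (g := fun ψ => L • (ψ v).1) (by fun_prop)
    (fun ψ x => by simp [hvw]) hL0 t0
  have E3 := measure_abs_inner_ge_le (d := d) v (g := fun ψ => codeNuisance ψ q r (ψ w).1)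
    (cN.clm_apply (cv w)) (fun ψ x => by simp [codeNuisance, hvw.symm, hqv, hrv]) hL0 t0
  have E4 := measure_abs_inner_ge_le (d := d) u (g := fun ψ => codeNuisance ψ q r (ψ v).1)
    (cN.clm_apply (cv v)) (fun ψ x => by simp [codeNuisance, huv.symm, hqu, hru]) hL0 t0
  have E5 := measure_abs_inner_ge_le (d := d) u
    (g := fun ψ => codeNuisance ψ q r (codeNuisance ψ q r (ψ w).1))
    (cN.clm_apply (cN.clm_apply (cv w)))
    (fun ψ x => by simp [codeNuisance, huw.symm, hqu, hru]) hL0 t0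
  have E6 := measure_abs_inner_ge_le (d := d) a
    (g := fun ψ => edgeOp (ψ u).1 (ψ v).1 (ψ w).1 (codeNuisance ψ q r)
      (edgeOp (ψ u).1 (ψ v).1 (ψ w).1 (codeNuisance ψ q r) (ψ b).1))
    (cG.clm_apply (cG.clm_apply (cv b)))
    (fun ψ x => by simp [codeNuisance, hau, hav, haw, hab.symm, hqa, hra]) hL0 t0
  have E0 := measure_norm_nuisance_gt_le (d := d) hqr hm hn
  have hL2 : L ^ 2 ≤ 5378 ^ 4 * m ^ 4 := by
    have : 5376 * m + 2 ≤ 5378 * m := by linarith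
    calc L ^ 2 = (5376 * m + 2) ^ 4 := by rw [hL]; ring
      _ ≤ (5378 * m) ^ 4 := by gcongr
      _ = _ := by ring
  set x : ℝ := d / (1024 * 5378 ^ 4 * m ^ 4) with hx
  have hexp : Real.exp (-(d * (1 / 16) ^ 2 / (4 * L ^ 2))) ≤ Real.exp (-x) := by
    apply Real.exp_le_exp.2
    apply neg_le_neg
    rw [show (d : ℝ) * (1 / 16) ^ 2 / (4 * L ^ 2) = d / (1024 * L ^ 2) by field_simp; ring]
    rw [hx]
    refine div_le_div_of_nonneg_left (Nat.cast_nonneg d) (by positivity) ?_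
    rw [mul_assoc]
    gcongr
  have hexp0 : Real.exp (-d) ≤ Real.exp (-x) := by
    apply Real.exp_le_exp.2
    apply neg_le_neg
    refine div_le_self (by positivity) ?_
    have : 1 ≤ m ^ 4 := one_le_pow₀ hm
    linarith
  have hle : ENNReal.ofReal (2 * Real.exp (-(d * (1 / 16) ^ 2 / (4 * L ^ 2)))) ≤
      2 * ENNReal.ofReal (Real.exp (-x)) := by
    rw [ENNReal.ofReal_mul two_pos.le, ENNReal.ofReal_ofNat]
    gcongr
  have hle0 := E0.trans (ENNReal.ofReal_le_ofReal hexp0)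
  -- The prefactor is `13 = 1 + 6 * 2`: the norm event and six two-sided caps.
  refine (measure_mono (fun ψ hψ => ?_)).trans ((measure_union_le _ _).trans ((add_le_add hle0
    ((measure_union_le _ _).trans (add_le_add (E1.trans hle)
    ((measure_union_le _ _).trans (add_le_add (E2.trans hle)
    ((measure_union_le _ _).trans (add_le_add (E3.trans hle)
    ((measure_union_le _ _).trans (add_le_add (E4.trans hle)
    ((measure_union_le _ _).trans (add_le_add (E5.trans hle)
      (E6.trans hle)))))))))))).trans (le_of_eq ?_)))
  · by_contra hcon
    simp only [Set.mem_union, not_or] at hcon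
    obtain ⟨h0, h1, h2, h3, h4, h5, h6⟩ := hcon
    have hnorm : ∀ i, ‖(ψ i).1‖ = 1 := fun i => by simp
    simp only [Set.mem_ofPred_eq, composedScore_eq] at hψ
    exact absurd (score_lt_score (hnorm u) (hnorm v) (hnorm w) (hnorm b)
      (by linarith : (1 : ℝ) ≤ 5376 * m) (not_lt.1 h0) le_rfl h1 h2 h3 h4 h5 h6) (not_lt.2 hψ)
  · rw [ENNReal.ofReal_mul (by norm_num), ENNReal.ofReal_ofNat]
    ring

/-! ### A dimension-free bound from sign symmetry. -/

/-- Cauchy–Schwarz for the components of `u` and `w` orthogonal to `v` says that the Gram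
determinant `1 + 2αβγ - α² - β² - γ²` is nonnegative, whence `2 + 2αβγ ≥ 1`. -/
lemma one_add_inner_mul_inner_mul_inner_pos {E : Type*} [NormedAddCommGroup E]
    [InnerProductSpace ℝ E] {u v w : E} (hu : ‖u‖ = 1) (hv : ‖v‖ = 1) (hw : ‖w‖ = 1) :
    0 < 1 + ⟪u, v⟫ * ⟪v, w⟫ * ⟪w, u⟫ := by
  have hu' : ⟪u, u⟫ = 1 := by rw [real_inner_self_eq_norm_sq, hu, one_pow]
  have hv' : ⟪v, v⟫ = 1 := by rw [real_inner_self_eq_norm_sq, hv, one_pow]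
  have hw' : ⟪w, w⟫ = 1 := by rw [real_inner_self_eq_norm_sq, hw, one_pow]
  have h := real_inner_mul_inner_self_le (u - ⟪u, v⟫ • v) (w - ⟪v, w⟫ • v)
  simp only [inner_sub_left, inner_sub_right, real_inner_smul_left, real_inner_smul_right, hu', hv',
    hw', real_inner_comm v u, real_inner_comm w v, real_inner_comm w u] at h ⊢
  nlinarith [sq_nonneg ⟪v, u⟫, sq_nonneg ⟪w, v⟫, sq_nonneg ⟪w, u⟫]

lemma nuisance_smul {d n : ℕ} (c : ℝ) (q r : Fin n → EuclideanSpace ℝ (Fin d)) :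
    nuisance (fun i => c • q i) r = c • nuisance q r := by
  ext1 x
  simp [nuisance_apply, Finset.smul_sum, smul_comm c]

/-- Some choice of signs of `u` and `N` makes the true score positive. -/
lemma exists_sign_score_pos {d : ℕ} {u v w : EuclideanSpace ℝ (Fin d)} (hu : ‖u‖ = 1)
    (hv : ‖v‖ = 1) (hw : ‖w‖ = 1)
    (N : EuclideanSpace ℝ (Fin d) →L[ℝ] EuclideanSpace ℝ (Fin d)) :
    ∃ s t : Bool, 0 < ⟪(bif s then (-1 : ℝ) else 1) • u,
      edgeOp ((bif s then (-1 : ℝ) else 1) • u) v w ((bif t then (-1 : ℝ) else 1) • N)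
        (edgeOp ((bif s then (-1 : ℝ) else 1) • u) v w ((bif t then (-1 : ℝ) else 1) • N) w)⟫ := by
  -- Averaging the four scores kills every term odd in `u` or in `N`; what remains is `1 + ⟪u, v⟫ *
  -- ⟪v, w⟫ * ⟪w, u⟫ > 0`.
  by_contra! h
  have hu' : ‖(-1 : ℝ) • u‖ = 1 := by simpa using hu
  have hu'' : ‖(1 : ℝ) • u‖ = 1 := by simpa using hu
  have h1 := h true true
  have h2 := h true false
  have h3 := h false true
  have h4 := h false false
  have hneg : ∀ x, ((-1 : ℝ) • N) x = -N x := fun x => by simp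
  have h5 := one_add_inner_mul_inner_mul_inner_pos hu hv hw
  simp only [cond_true, cond_false] at h1 h2 h3 h4
  rw [inner_edgeOp_edgeOp hu' hv hw] at h1 h2
  rw [inner_edgeOp_edgeOp hu'' hv hw] at h3 h4
  simp only [hneg, neg_smul, one_smul, inner_neg_left, inner_neg_right, map_neg, neg_neg]
    at h1 h2 h3 h4
  linarith

open Classical in
/-- Flip the signs of the codes indexed by `s`. -/
noncomputable def signFlip {ι : Type*} {d : ℕ} (s : Set ι) (ψ : ι → UnitSphere d) (i : ι) :
    UnitSphere d :=
  if i ∈ s then -ψ i else ψ i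

lemma signFlip_congr {ι : Type*} {d : ℕ} {s t : Set ι} {i : ι} (h : i ∈ s ↔ i ∈ t)
    (ψ : ι → UnitSphere d) : signFlip s ψ i = signFlip t ψ i := by
  by_cases hs : i ∈ s
  · rw [signFlip, signFlip, if_pos hs, if_pos (h.1 hs)]
  · rw [signFlip, signFlip, if_neg hs, if_neg (mt h.2 hs)]

lemma measurePreserving_signFlip {ι : Type*} [Fintype ι] {d : ℕ} [NeZero d] (s : Set ι) :
    MeasurePreserving (signFlip s) (Measure.pi fun _ : ι => sphereUniform d)
      (Measure.pi fun _ : ι => sphereUniform d) := by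
  classical
  refine measurePreserving_pi _ _ (f := fun i x => if i ∈ s then -x else x) fun i => ?_
  by_cases h : i ∈ s
  · simpa [h] using measurePreserving_neg_sphereUniform d
  · simpa [h, Function.id_def] using MeasurePreserving.id (sphereUniform d)

/-- If every configuration lies in `S` after one of `n` families of sign flips, then `S` has measure
at least `1 / n`. -/
lemma one_le_card_mul_measure {ι κ : Type*} [Fintype ι] [Fintype κ] {d : ℕ} [NeZero d]
    (s : κ → Set ι) {S : Set (ι → UnitSphere d)} (hS : MeasurableSet S)
    (h : ∀ ψ, ∃ c, signFlip (s c) ψ ∈ S) :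
    1 ≤ Fintype.card κ * (Measure.pi fun _ : ι => sphereUniform d) S := by
  calc (1 : ℝ≥0∞) = (Measure.pi fun _ : ι => sphereUniform d) Set.univ := measure_univ.symm
    _ ≤ (Measure.pi fun _ : ι => sphereUniform d) (⋃ c, signFlip (s c) ⁻¹' S) :=
        measure_mono fun ψ _ => Set.mem_iUnion.2 (h ψ)
    _ ≤ ∑ c, (Measure.pi fun _ : ι => sphereUniform d) (signFlip (s c) ⁻¹' S) :=
        measure_iUnion_fintype_le _ _
    _ = _ := by
        simp [fun c => (measurePreserving_signFlip (d := d) (s c)).measure_preimage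
          hS.nullMeasurableSet]

lemma continuous_composedScore {ι : Type*} {d n : ℕ} (u v w : ι) (q r : Fin n → ι) (x y : ι) :
    Continuous fun ψ : ι → UnitSphere d => composedScore ψ u v w q r x y := by
  simp only [composedScore_eq]
  have cG := continuous_edgeOp (d := d) u v w q r
  have cv : ∀ i : ι, Continuous fun ψ : ι → UnitSphere d => (ψ i).1 := fun i => by fun_prop
  exact (cv x).inner (cG.clm_apply (cG.clm_apply (cv y)))

/-- A spurious score is below the true score with probability at least `1 / 8`. -/
lemma measure_score_le_score_le_seven_eighths {d n : ℕ} [NeZero d] {ι : Type*} [Fintype ι]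
    {u v w a b : ι} {q r : Fin n → ι} (hinj : Function.Injective (graphVertex u v w q r))
    (ha : a ∉ Set.range (graphVertex u v w q r))
    (hab : a ≠ b) :
    (Measure.pi fun _ : ι => sphereUniform d)
      {ψ | composedScore ψ u v w q r u w ≤ composedScore ψ u v w q r a b} ≤
      ENNReal.ofReal (7 / 8) := by
  have hne : ∀ i j, i ≠ j → graphVertex u v w q r i ≠ graphVertex u v w q r j :=
    fun i j h => hinj.ne h
  have huv : u ≠ v := hne (.inl 0) (.inl 1) (by simp)
  have huw : u ≠ w := hne (.inl 0) (.inl 2) (by simp)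
  have hqu : ∀ i, q i ≠ u := fun i => hne (.inr (.inl i)) (.inl 0) (by simp)
  have hru : ∀ i, r i ≠ u := fun i => hne (.inr (.inr i)) (.inl 0) (by simp)
  have hqv : ∀ i, q i ≠ v := fun i => hne (.inr (.inl i)) (.inl 1) (by simp)
  have hqw : ∀ i, q i ≠ w := fun i => hne (.inr (.inl i)) (.inl 2) (by simp)
  have hrq : ∀ i j, r i ≠ q j := fun i j => hne (.inr (.inr i)) (.inr (.inl j)) (by simp)
  have hau : u ≠ a := fun h => ha ⟨.inl 0, h⟩
  have hav : v ≠ a := fun h => ha ⟨.inl 1, h⟩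
  have haw : w ≠ a := fun h => ha ⟨.inl 2, h⟩
  have hqa : ∀ i, q i ≠ a := fun i h => ha ⟨.inr (.inl i), h⟩
  have hra : ∀ i, r i ≠ a := fun i h => ha ⟨.inr (.inr i), h⟩
  set S : Set (ι → UnitSphere d) :=
    {ψ | composedScore ψ u v w q r u w ≤ composedScore ψ u v w q r a b} with hS
  have hSm : MeasurableSet S :=
    (isClosed_le (continuous_composedScore u v w q r u w)
      (continuous_composedScore u v w q r a b)).measurableSet
  have key := one_le_card_mul_measure (d := d) (fun c : Bool × Bool × Bool =>
    {i | (i = u ∧ c.1) ∨ ((∃ j, q j = i) ∧ c.2.1) ∨ (i = a ∧ c.2.2)}) hSm.compl fun ψ => by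
      have hnorm : ∀ i, ‖(ψ i).1‖ = 1 := fun i => by simp
      obtain ⟨s, t, hst⟩ := exists_sign_score_pos (hnorm u) (hnorm v) (hnorm w)
        (codeNuisance ψ q r)
      set u' := (bif s then (-1 : ℝ) else 1) • (ψ u).1
      set N' := (bif t then (-1 : ℝ) else 1) • codeNuisance ψ q r with hN'
      -- The sign of `a` is chosen last, to make the spurious score nonpositive; it affects neither
      -- the graph nor `b`. The code of `b` may itself have been flipped, since `b` may be a graph
      -- vertex here.
      obtain ⟨b', c, hb', hc⟩ : ∃ (b' : EuclideanSpace ℝ (Fin d)) (c : Bool),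
          (b' = (signFlip {i | (i = u ∧ s) ∨ ((∃ j, q j = i) ∧ t) ∨ (i = a ∧ c)} ψ b).1) ∧
          (bif c then (-1 : ℝ) else 1) * ⟪(ψ a).1, edgeOp u' (ψ v).1 (ψ w).1 N'
            (edgeOp u' (ψ v).1 (ψ w).1 N' b')⟫ ≤ 0 := by
        set b' := (signFlip {i | (i = u ∧ s) ∨ ((∃ j, q j = i) ∧ t)} ψ b).1 with hb'
        have hbc : ∀ c : Bool, b' =
            (signFlip {i | (i = u ∧ s) ∨ ((∃ j, q j = i) ∧ t) ∨ (i = a ∧ c)} ψ b).1 := fun c => by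
          rw [hb', signFlip_congr (t := {i | (i = u ∧ s) ∨ ((∃ j, q j = i) ∧ t) ∨ (i = a ∧ c)})]
          simp [hab.symm]
        rcases le_total 0 ⟪(ψ a).1, edgeOp u' (ψ v).1 (ψ w).1 N'
            (edgeOp u' (ψ v).1 (ψ w).1 N' b')⟫ with h | h
        · exact ⟨b', true, hbc true, by simpa using h⟩
        · exact ⟨b', false, hbc false, by simpa using h⟩
      refine ⟨(s, t, c), ?_⟩
      set F := {i | (i = u ∧ s) ∨ ((∃ j, q j = i) ∧ t) ∨ (i = a ∧ c)} with hF
      have fu : (signFlip F ψ u).1 = u' := by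
        cases s <;> simp [signFlip, F, u', hau, hqu]
      have fv : (signFlip F ψ v).1 = (ψ v).1 := by
        simp [signFlip, F, huv.symm, hav, hqv]
      have fw : (signFlip F ψ w).1 = (ψ w).1 := by
        simp [signFlip, F, huw.symm, haw, hqw]
      have fa : (signFlip F ψ a).1 = (bif c then (-1 : ℝ) else 1) • (ψ a).1 := by
        cases c <;> simp [signFlip, F, hau.symm, hqa]
      have fq : ∀ i, (signFlip F ψ (q i)).1 = (bif t then (-1 : ℝ) else 1) • (ψ (q i)).1 := fun i => by
        cases t <;> simp [signFlip, F, hqu, hqa]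
      have fr : ∀ i, (signFlip F ψ (r i)).1 = (ψ (r i)).1 := fun i => by
        simp [signFlip, F, hru, hra, fun j => (hrq i j).symm]
      have fN : codeNuisance (signFlip F ψ) q r = N' := by
        rw [hN', codeNuisance, codeNuisance, ← nuisance_smul]
        simp only [fq, fr]
      show ¬ (composedScore (signFlip F ψ) u v w q r u w ≤ composedScore (signFlip F ψ) u v w q r a b)
      rw [composedScore_eq, composedScore_eq, fu, fv, fw, fa, fN, ← hb', not_le,
        real_inner_smul_left (ψ a).1]
      exact hc.trans_lt hst
  have hr : 1 ≤ 8 * (Measure.pi fun _ : ι => sphereUniform d).real Sᶜ := by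
    have := ENNReal.toReal_mono (by finiteness) key
    simpa [measureReal_def] using this
  rw [probReal_compl_eq_one_sub hSm] at hr
  rw [ENNReal.le_ofReal_iff_toReal_le (measure_ne_top _ _) (by norm_num)]
  change (Measure.pi fun _ : ι => sphereUniform d).real S ≤ 7 / 8
  linarith

/-! ### The exponential rate and its comparison with `σ²`. -/

/-- For `x ≤ 4`, `exp (-x/40) ≥ 9/10 > 7/8`; for `x ≥ 4`, the spare factor `exp (39x/40) ≥ e³`
exceeds 13. -/
lemma le_exp_of_le_exp_of_le {p x : ℝ} (h1 : p ≤ 13 * Real.exp (-x)) (h2 : p ≤ 7 / 8) :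
    p ≤ Real.exp (-(x / 40)) := by
  rcases le_total x 4 with h | h
  · have := Real.add_one_le_exp (-(x / 40))
    linarith
  · refine h1.trans ?_
    have e : Real.exp (-(x / 40)) = Real.exp (39 * x / 40) * Real.exp (-x) := by
      rw [← Real.exp_add]; ring_nf
    rw [e]
    gcongr
    have h3 : Real.exp (3 : ℕ) ≤ Real.exp (39 * x / 40) := by
      apply Real.exp_le_exp.2; push_cast; linarith
    refine le_trans ?_ h3
    rw [← mul_one ((3 : ℕ) : ℝ), Real.exp_nat_mul]
    have := Real.exp_one_gt_d9
    calc (13 : ℝ) ≤ 2.7 ^ 3 := by norm_num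
      _ ≤ _ := by gcongr; linarith

/-- The rate of decay of the probability of a single misclassification. -/
lemma measure_score_le_score_le_exp {d k : ℕ} [NeZero d] {ι : Type*} [Fintype ι]
    {u v w a b : ι} {q r : Fin (k - 2) → ι} (hinj : Function.Injective (graphVertex u v w q r))
    (ha : a ∉ Set.range (graphVertex u v w q r)) (hab : a ≠ b) :
    (Measure.pi fun _ : ι => sphereUniform d)
      {ψ | composedScore ψ u v w q r u w ≤ composedScore ψ u v w q r a b} ≤
      ENNReal.ofReal (Real.exp (-(1 / (40960 * 5378 ^ 4) * (d ^ 3 / (d + k) ^ 2)))) := by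
  have hd : (0 : ℝ) < d := by exact_mod_cast Nat.pos_of_ne_zero (NeZero.ne d)
  have hm2 : √(1 + k / d : ℝ) ^ 2 = 1 + k / d := Real.sq_sqrt (by positivity)
  have hm1 : 1 ≤ √(1 + k / d : ℝ) := by
    rw [Real.one_le_sqrt]
    have : (0 : ℝ) ≤ k / d := by positivity
    linarith
  have hn : ((k - 2 : ℕ) : ℝ) ≤ d * √(1 + k / d : ℝ) ^ 2 := by
    rw [hm2, mul_add, mul_one, mul_div_cancel₀ _ hd.ne']
    have : ((k - 2 : ℕ) : ℝ) ≤ k := by exact_mod_cast Nat.sub_le k 2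
    linarith
  have h1 := measure_score_le_score_le (d := d) hinj ha hab hm1 hn
  have h2 := measure_score_le_score_le_seven_eighths (d := d) hinj ha hab
  have h1' := ENNReal.toReal_le_of_le_ofReal (by positivity) h1
  have h2' := ENNReal.toReal_le_of_le_ofReal (by norm_num) h2
  rw [ENNReal.le_ofReal_iff_toReal_le (measure_ne_top _ _) (Real.exp_pos _).le]
  refine (le_exp_of_le_exp_of_le h1' h2').trans (le_of_eq ?_)
  congr 2
  rw [show √(1 + k / d : ℝ) ^ 4 = (√(1 + k / d : ℝ) ^ 2) ^ 2 by ring, hm2]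
  field_simp
  ring

lemma sq_div_cube_le_noiseVar {d k : ℕ} (hd : 1 ≤ d) (hk : 2 ≤ k) :
    (k : ℝ) ^ 2 / d ^ 3 ≤ noiseVar d k := by
  have hd' : (0 : ℝ) < d := by exact_mod_cast hd
  have hk' : (2 : ℝ) ≤ k := by exact_mod_cast hk
  have h1 : 0 ≤ (2 * (k : ℝ) - 1) / (d : ℝ) ^ 2 := div_nonneg (by linarith) (by positivity)
  have h2 : (k : ℝ) ^ 2 / d ^ 3 ≤ (2 * (k : ℝ) ^ 2 - 2 * (k : ℝ)) / (d : ℝ) ^ 3 := by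
    gcongr
    -- This is `k² ≤ 2k² - 2k`, which uses `k ≥ 2`.
    nlinarith
  rw [noiseVar]
  linarith

lemma inv_noiseVar_le {d k : ℕ} (hd : 1 ≤ d) (hk : 2 ≤ k) :
    (noiseVar d k)⁻¹ ≤ (d : ℝ) ^ 3 / k ^ 2 := by
  have hd' : (0 : ℝ) < d := by exact_mod_cast hd
  have hk' : (0 : ℝ) < k := by exact_mod_cast (by omega : 0 < k)
  rw [← inv_div]
  exact inv_anti₀ (by positivity) (sq_div_cube_le_noiseVar hd hk)

lemma exp_rate_le_add {d k : ℕ} (hd : 1 ≤ d) (hk : 2 ≤ k) {c : ℝ} (hc : 0 ≤ c) :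
    Real.exp (-(c * (d ^ 3 / (d + k) ^ 2))) ≤
      Real.exp (-(c / 4) / noiseVar d k) + Real.exp (-(c / 4) * d) := by
  have hd' : (0 : ℝ) < d := by exact_mod_cast hd
  have hk' : (0 : ℝ) < k := by exact_mod_cast (by omega : 0 < k)
  rcases le_total (k : ℝ) d with h | h
  · refine le_trans (Real.exp_le_exp.2 ?_) (le_add_of_nonneg_left (Real.exp_pos _).le)
    have : (d : ℝ) / 4 ≤ d ^ 3 / (d + k) ^ 2 := by
      calc (d : ℝ) / 4 = d ^ 3 / (d + d) ^ 2 := by field_simp; ring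
        _ ≤ _ := by gcongr
    nlinarith
  · refine le_trans (Real.exp_le_exp.2 ?_) (le_add_of_nonneg_right (Real.exp_pos _).le)
    have : (noiseVar d k)⁻¹ / 4 ≤ (d : ℝ) ^ 3 / (d + k) ^ 2 := by
      calc (noiseVar d k)⁻¹ / 4 ≤ (d : ℝ) ^ 3 / k ^ 2 / 4 := by
            gcongr; exact inv_noiseVar_le hd hk
        _ = (d : ℝ) ^ 3 / (k + k) ^ 2 := by field_simp; ring
        _ ≤ _ := by gcongr
    rw [div_eq_mul_inv _ (noiseVar d k)]
    nlinarith

lemma exp_rate_le {d k : ℕ} (hd : 1 ≤ d) (hk : 2 ≤ k) {c κ : ℝ} (hc : 0 ≤ c) (hκ : 0 < κ)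
    (h : κ * d ≤ k) :
    Real.exp (-(c * (d ^ 3 / (d + k) ^ 2))) ≤
      Real.exp (-(c / (1 + 1 / κ) ^ 2) * (d : ℝ) ^ 3 / (k : ℝ) ^ 2) := by
  have hd' : (0 : ℝ) < d := by exact_mod_cast hd
  have hk' : (0 : ℝ) < k := by exact_mod_cast (by omega : 0 < k)
  apply Real.exp_le_exp.2
  rw [neg_mul, neg_div]
  apply neg_le_neg
  have h1 : (d : ℝ) + k ≤ (1 + 1 / κ) * k := by
    have : (d : ℝ) ≤ 1 / κ * k := by
      rw [one_div, le_inv_mul_iff₀ hκ]; exact h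
    linarith
  calc c / (1 + 1 / κ) ^ 2 * (d : ℝ) ^ 3 / (k : ℝ) ^ 2
      = c * ((d : ℝ) ^ 3 / ((1 + 1 / κ) * k) ^ 2) := by field_simp
    _ ≤ _ := by gcongr

lemma exp_cube_div_sq_le {d k : ℕ} (hd : 1 ≤ d) (hk : 2 ≤ k) {c : ℝ} (hc : 0 ≤ c) :
    Real.exp (-c * (d : ℝ) ^ 3 / (k : ℝ) ^ 2) ≤ Real.exp (-c / noiseVar d k) := by
  apply Real.exp_le_exp.2
  have := inv_noiseVar_le hd hk
  rw [mul_div_assoc, div_eq_mul_inv _ (noiseVar d k)]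
  nlinarith

/-! ### Transfer to arbitrary vertex sets and the union bound. -/

/-- The probability that one spurious edge defeats the composed edge. -/
lemma measure_spurious_ge_le {d k : ℕ} [NeZero d] {V : Type*} {u v w : V} {q r : Fin (k - 2) → V}
    {a b : V} (hinj : Function.Injective (graphVertex u v w q r))
    (ha : a ∉ Set.range (graphVertex u v w q r)) (hb : b ∉ Set.range (graphVertex u v w q r))
    (hab : a ≠ b) {Ω : Type*} [MeasurableSpace Ω] (P : Measure Ω) [IsProbabilityMeasure P]
    {φ : V → Ω → UnitSphere d} (hφ : ∀ x, HasLaw (φ x) (sphereUniform d) P) (hind : iIndepFun φ P) :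
    P.real {ω | composedScore (fun x => φ x ω) u v w q r u w ≤
      composedScore (fun x => φ x ω) u v w q r a b} ≤
      Real.exp (-(1 / (40960 * 5378 ^ 4) * (d ^ 3 / (d + k) ^ 2))) := by
  -- `V` may be infinite, so the problem is moved to the product law of the `2k + 1` codes that
  -- occur.
  set e : Fin 2 ⊕ (Fin 3 ⊕ (Fin (k - 2) ⊕ Fin (k - 2))) → V :=
    Sum.elim ![a, b] (graphVertex u v w q r) with he
  have hinj2 : Function.Injective ![a, b] := by
    intro i j hij
    fin_cases i <;> fin_cases j <;> simp_all
  have heinj : Function.Injective e := by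
    refine hinj2.sumElim hinj fun i j hij => ?_
    fin_cases i
    · exact ha ⟨j, hij.symm⟩
    · exact hb ⟨j, hij.symm⟩
  have hmeas : ∀ i, AEMeasurable (φ (e i)) P := fun i => (hφ (e i)).aemeasurable
  have hmap : P.map (fun ω i => φ (e i) ω) = Measure.pi fun _ => sphereUniform d := by
    rw [(hind.precomp heinj).map_fun_eq_pi_map hmeas]
    congr 1
    ext1 i
    exact (hφ (e i)).map_eq
  have hgv : graphVertex (Sum.inr (Sum.inl 0)) (Sum.inr (Sum.inl 1)) (Sum.inr (Sum.inl 2))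
      (fun i => Sum.inr (Sum.inr (Sum.inl i))) (fun i => Sum.inr (Sum.inr (Sum.inr i))) =
      (Sum.inr : _ → Fin 2 ⊕ (Fin 3 ⊕ (Fin (k - 2) ⊕ Fin (k - 2)))) := by
    ext1 i
    rcases i with i | i | i
    · fin_cases i <;> rfl
    · rfl
    · rfl
  have key := measure_score_le_score_le_exp (d := d) (k := k)
    (ι := Fin 2 ⊕ (Fin 3 ⊕ (Fin (k - 2) ⊕ Fin (k - 2)))) (a := .inl 0) (b := .inl 1)
    (u := .inr (.inl 0)) (v := .inr (.inl 1)) (w := .inr (.inl 2))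
    (q := fun i => .inr (.inr (.inl i))) (r := fun i => .inr (.inr (.inr i)))
    (by rw [hgv]; exact Sum.inr_injective) (by rw [hgv]; simp) (by simp)
  rw [← hmap, Measure.map_apply_of_aemeasurable (aemeasurable_pi_lambda _ hmeas)
    (isClosed_le (continuous_composedScore _ _ _ _ _ _ _)
      (continuous_composedScore _ _ _ _ _ _ _)).measurableSet] at key
  exact ENNReal.toReal_le_of_le_ofReal (Real.exp_pos _).le key

/-- The union bound over the spurious edges. -/
lemma one_sub_mul_le_measureReal {Ω : Type*} [MeasurableSpace Ω] (P : Measure Ω)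
    [IsProbabilityMeasure P] {M : ℕ} {T : Ω → ℝ} {F : Fin M → Ω → ℝ} {p : ℝ}
    (h : ∀ m, P.real {ω | T ω ≤ F m ω} ≤ p) :
    1 - M * p ≤ P.real {ω | ∀ m, F m ω < T ω} := by
  have hcover : (Set.univ : Set Ω) ⊆ {ω | ∀ m, F m ω < T ω} ∪ ⋃ m, {ω | T ω ≤ F m ω} := by
    intro ω _
    by_cases hω : ∀ m, F m ω < T ω
    · exact Or.inl hω
    · push Not at hω
      exact Or.inr (Set.mem_iUnion.2 hω)
  have h1 : P.real (⋃ m, {ω | T ω ≤ F m ω}) ≤ M * p := by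
    refine (measureReal_iUnion_fintype_le _).trans ((Finset.sum_le_sum fun m _ => h m).trans ?_)
    simp
  have h2 := (measureReal_mono hcover).trans (measureReal_union_le (μ := P) _ _)
  rw [probReal_univ] at h2
  linarith

end TensorSpherical

theorem mainTheorem8 :
    ∃ C₀ : ℝ, 0 < C₀ ∧ ∀ κ : ℝ, 0 < κ → ∃ C : ℝ, 0 < C ∧
      ∀ (d k M : ℕ), 1 ≤ d → 2 ≤ k →
      -- the graph, with all its vertices distinct, and the spurious edges
      ∀ (V : Type*) (u v w : V) (q r : Fin (k - 2) → V) (a b : Fin M → V),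
        Function.Injective (TensorSpherical.graphVertex u v w q r) →
        (∀ m, a m ∉ Set.range (TensorSpherical.graphVertex u v w q r)) →
        (∀ m, b m ∉ Set.range (TensorSpherical.graphVertex u v w q r)) →
        (∀ m, a m ≠ b m) →
      -- independent vertex codes, each uniformly distributed on the unit sphere
      ∀ (Ω : Type*) [MeasurableSpace Ω] (P : Measure Ω) [IsProbabilityMeasure P]
        (φ : V → Ω → TensorSpherical.UnitSphere d),
        (∀ x, HasLaw (φ x) (TensorSpherical.sphereUniform d) P) → iIndepFun φ P →
      -- the true query score, the spurious query scores, and the event of correct recovery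
      ∀ (T : Ω → ℝ) (F : Fin M → Ω → ℝ) (A : Set Ω),
        (∀ ω, T ω = TensorSpherical.composedScore (fun x => φ x ω) u v w q r u w) →
        (∀ m ω, F m ω =
          TensorSpherical.composedScore (fun x => φ x ω) u v w q r (a m) (b m)) →
        A = {ω | ∀ m, F m ω < T ω} →
        1 - (M : ℝ) * (Real.exp (-C₀ / TensorSpherical.noiseVar d k) + Real.exp (-C₀ * d))
            ≤ P.real A ∧
        (κ * d ≤ k →
          1 - (M : ℝ) * Real.exp (-C / TensorSpherical.noiseVar d k) ≤ P.real A ∧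
          1 - (M : ℝ) * Real.exp (-C * (d : ℝ) ^ 3 / (k : ℝ) ^ 2) ≤ P.real A) := by
  set c : ℝ := 1 / (40960 * 5378 ^ 4) with hc
  have hc0 : 0 < c := by positivity
  -- The `1/4` comes from `d + k ≤ 2 max(d, k)`, the other constant from `d + k ≤ (1 + 1/κ) k`.
  refine ⟨c / 4, by positivity, fun κ hκ => ⟨c / (1 + 1 / κ) ^ 2, by positivity, ?_⟩⟩
  intro d k M hd hk V u v w q r a b hinj ha hb hab Ω _ P _ φ hφ hind T F A hT hF hA
  have : NeZero d := ⟨by omega⟩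
  have key : ∀ m, P.real {ω | T ω ≤ F m ω} ≤ Real.exp (-(c * (d ^ 3 / (d + k) ^ 2))) := fun m => by
    simp only [hT, hF]
    exact TensorSpherical.measure_spurious_ge_le hinj (ha m) (hb m) (hab m) P hφ hind
  rw [hA]
  refine ⟨TensorSpherical.one_sub_mul_le_measureReal P fun m =>
    (key m).trans (TensorSpherical.exp_rate_le_add hd hk hc0.le), fun h => ?_⟩
  have h2 := TensorSpherical.exp_rate_le hd hk hc0.le hκ h
  exact ⟨TensorSpherical.one_sub_mul_le_measureReal P fun m => (key m).trans
      (h2.trans (TensorSpherical.exp_cube_div_sq_le hd hk (by positivity))),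
    TensorSpherical.one_sub_mul_le_measureReal P fun m => (key m).trans h2⟩
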